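/- Let $d\ge 3$, $d/2\le s\le\infty$, and let $V\ge 0$ be a locally integrable function on $\mathbb R^d$, not a.e. zero, in the reverse Hölder class $RH_s$: for some $C>0$, $\big(\frac1{|B|}\int_B V^s\big)^{1/s}\le \frac{C}{|B|}\int_B V$ for all balls $B$ (with $\operatorname{ess\,sup}_B V$ on the left if $s=\infty$). Let $$\rho(x)=\sup\Big\{r>0:\ r^{2-d}\int_{B(x,r)}V\le 1\Big\}$$ be the critical radius function. Call $(C_0,N_0)$ with $C_0\ge1$, $N_0>0$ *admissible* if for all $x,y\in\mathbb R^d$ $$\frac1{C_0}\Big(1+\frac{|x-y|}{\rho(x)}\Big)^{-N_0}\le\frac{\rho(y)}{\rho(x)}\le C_0\Big(1+\frac{|x-y|}{\rho(x)}\Big)^{\frac{N_0}{N_0+1}} .$$ For $0<\beta<1$, $\theta>0$, the space $\mathcal C^{\beta,*}_{\rho,\theta}$ consists of the real-valued $f\in L^1_{\rm loc}(\mathbb R^d)$ with $$\|f\|_{\mathcal C^{\beta,*}_{\rho,\theta}}=\sup_{B=B(x_0,r)}\Big(1+\frac r{\rho(x_0)}\Big)^{-\theta}\frac1{|B|^{1+\beta/d}}\int_B\big[f-\operatorname*{ess\,inf}_B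 f\big]\,dx<\infty .$$ For $1\le p<q<\infty$, $\theta>0$, the class $A^{\rho,\theta}_{p,q}$ consists of the locally integrable $\omega\ge0$, not a.e. zero, with $$[\omega]_{A^{\rho,\theta}_{p,q}}=\sup_{B=B(x_0,r)}\Big(1+\frac r{\rho(x_0)}\Big)^{-\theta}\Big(\frac1{|B|}\int_B\omega^q\Big)^{1/q}\Big(\frac1{|B|}\int_B\omega^{-p'}\Big)^{1/p'}<\infty,\qquad \frac1p+\frac1{p'}=1,$$ where for $p=1$ the last factor is replaced by $(\operatorname{ess\,inf}_B\omega)^{-1}$. For a ball $B=B(x_0,r)$ put $\omega^p(B)=\int_B\omega^p$ and $$\Phi_{f,\omega}(B)=\frac{|B|^{1/p-1/q-\beta/d}}{[\omega^p(B)]^{1/p}}\Big(\int_B\big[f-\operatorname*{ess\,inf}_B f\big]^q\omega^q\,dx\Big)^{1/q}.$$ Admissible pairs $(C_0,N_0)$ exist, and the following hold. (1) For every admissible $(C_0,N_0)$ and all $0<\beta<1$, $\theta_1>0$ there is a constant $C>0$ such that for all $1\le p<q<\infty$, $\theta_2>0$, $\omega\in A^{\rho,\theta_2}_{p,q}$,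 $f\in\mathcal C^{\beta,*}_{\rho,\theta_1}$ and all balls $B=B(x_0,r)$, $$\Phi_{f,\omega}(B)\le C\,[\omega]_{A^{\rho,\theta_2}_{p,q}}\Big(1+\frac r{\rho(x_0)}\Big)^{(N_0+1)\theta_1+\theta_2}\|f\|_{\mathcal C^{\beta,*}_{\rho,\theta_1}} .$$ (2) Conversely, let $1\le p<q<\infty$, $0<\beta<1$, $\theta_1,\theta_2>0$, $\omega\in A^{\rho,\theta_2}_{p,q}$ and let $f$ be a real-valued measurable function. If for some $C>0$ and all balls $B=B(x_0,r)$ $$\Phi_{f,\omega}(B)\le C\,[\omega]_{A^{\rho,\theta_2}_{p,q}}\Big(1+\frac r{\rho(x_0)}\Big)^{\theta_1-\theta_2},$$ then $f\in\mathcal C^{\beta,*}_{\rho,\theta_1}$ and $\|f\|_{\mathcal C^{\beta,*}_{\rho,\theta_1}}\le C'\,[\omega]_{A^{\rho,\theta_2}_{p,q}}$ with $C'=C\,[\omega]_{A^{\rho,\theta_2}_{p,q}}$. -/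

import Mathlib

open MeasureTheory Metric
open scoped ENNReal

noncomputable section

namespace SchrodingerCampanato

variable {d : ℕ}

/-- The reverse Hölder class `RH_s` for `1 < s ≤ ∞`: a nonnegative locally integrable `V` such that
`(⨍_B V ^ s) ^ (1/s) ≤ C ⨍_B V` for all balls, the left side being `ess sup_B V` for `s = ∞`. -/
structure ReverseHolder (s : ℝ≥0∞) (V : EuclideanSpace ℝ (Fin d) → ℝ) : Prop where
  one_lt : 1 < s
  nonneg : ∀ x, 0 ≤ V x
  locallyIntegrable : LocallyIntegrable V volume
  bound : ∃ C : ℝ, 0 < C ∧ ∀ (x : EuclideanSpace ℝ (Fin d)) (r : ℝ), 0 < r →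
    (if s = ⊤ then essSup (fun y => ENNReal.ofReal (V y)) (volume.restrict (ball x r))
      else (⨍⁻ y in ball x r, ENNReal.ofReal (V y) ^ s.toReal ∂volume) ^ (1 / s.toReal))
    ≤ ENNReal.ofReal C * ⨍⁻ y in ball x r, ENNReal.ofReal (V y) ∂volume

/-- The critical radius `ρ(x) = sup {r > 0 : r ^ (2 - d) ∫_{B(x,r)} V ≤ 1}` of the potential `V`. -/
def criticalRadius (V : EuclideanSpace ℝ (Fin d) → ℝ) (x : EuclideanSpace ℝ (Fin d)) : ℝ :=
  sSup {r : ℝ | 0 < r ∧ 1 / r ^ (d - 2) * ∫ y in ball x r, V y ∂volume ≤ 1}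

/-- The constants `C₀`, `N₀` control the variation of `ρ`:
`C₀⁻¹ (1 + |x-y|/ρ(x)) ^ (-N₀) ≤ ρ(y)/ρ(x) ≤ C₀ (1 + |x-y|/ρ(x)) ^ (N₀/(N₀+1))`. -/
def SlowlyVarying (ρ : EuclideanSpace ℝ (Fin d) → ℝ) (C₀ N₀ : ℝ) : Prop :=
  ∀ x y : EuclideanSpace ℝ (Fin d),
    1 / C₀ * (1 + dist x y / ρ x) ^ (-N₀) ≤ ρ y / ρ x ∧
    ρ y / ρ x ≤ C₀ * (1 + dist x y / ρ x) ^ (N₀ / (N₀ + 1))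

/-- The factor `(1 + r/ρ(x)) ^ θ`. -/
def growth (ρ : EuclideanSpace ℝ (Fin d) → ℝ) (θ : ℝ) (x : EuclideanSpace ℝ (Fin d)) (r : ℝ) :
    ℝ≥0∞ :=
  ENNReal.ofReal ((1 + r / ρ x) ^ θ)

/-- `f(x) - ess inf_B f`, as an extended nonnegative number. The essential infimum is taken in
`[-∞, ∞]`, so the value is `∞` if `f` is not essentially bounded below on `B`. -/
def lowerOsc (f : EuclideanSpace ℝ (Fin d) → ℝ) (B : Set (EuclideanSpace ℝ (Fin d)))
    (x : EuclideanSpace ℝ (Fin d)) : ℝ≥0∞ :=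
  ((f x : EReal) - essInf (fun y => (f y : EReal)) (volume.restrict B)).toENNReal

/-- `|B| ^ (-(1 + β/d)) ∫_B [f - ess inf_B f]` for `B = B(x₀, r)`. -/
def campanatoMean (β : ℝ) (f : EuclideanSpace ℝ (Fin d) → ℝ) (x₀ : EuclideanSpace ℝ (Fin d))
    (r : ℝ) : ℝ≥0∞ :=
  volume (ball x₀ r) ^ (-(1 + β / d)) * ∫⁻ x in ball x₀ r, lowerOsc f (ball x₀ r) x ∂volume

/-- Membership in the space `C^{β,*}_{ρ,θ}`. -/
def MemCampanato (ρ : EuclideanSpace ℝ (Fin d) → ℝ) (β θ : ℝ)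
    (f : EuclideanSpace ℝ (Fin d) → ℝ) : Prop :=
  LocallyIntegrable f volume ∧ ∃ C : ℝ, 0 < C ∧
    ∀ (x₀ : EuclideanSpace ℝ (Fin d)) (r : ℝ), 0 < r →
      campanatoMean β f x₀ r ≤ ENNReal.ofReal C * growth ρ θ x₀ r

/-- The `C^{β,*}_{ρ,θ}`-constant of `f`. -/
def campanatoConst (ρ : EuclideanSpace ℝ (Fin d) → ℝ) (β θ : ℝ)
    (f : EuclideanSpace ℝ (Fin d) → ℝ) : ℝ≥0∞ :=
  ⨆ (x₀ : EuclideanSpace ℝ (Fin d)) (r : ℝ) (_ : 0 < r),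
    growth ρ (-θ) x₀ r * campanatoMean β f x₀ r

/-- A weight: nonnegative, locally integrable, and not almost everywhere zero. -/
structure IsWeight (ω : EuclideanSpace ℝ (Fin d) → ℝ) : Prop where
  nonneg : ∀ x, 0 ≤ ω x
  locallyIntegrable : LocallyIntegrable ω volume
  not_ae_zero : ¬ ω =ᵐ[volume] 0

/-- `(⨍_B ω ^ q) ^ (1/q)`. -/
def meanPow (q : ℝ) (ω : EuclideanSpace ℝ (Fin d) → ℝ) (B : Set (EuclideanSpace ℝ (Fin d))) :
    ℝ≥0∞ :=
  (⨍⁻ x in B, ENNReal.ofReal (ω x) ^ q ∂volume) ^ (1 / q)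

/-- `(⨍_B ω ^ (-p')) ^ (1/p')` with `p' = p/(p-1)` if `p ≠ 1`, and `(ess inf_B ω)⁻¹` if `p = 1`.
Here `0 ^ (-p') = ∞` and `0⁻¹ = ∞`. -/
def dualMean (p : ℝ) (ω : EuclideanSpace ℝ (Fin d) → ℝ) (B : Set (EuclideanSpace ℝ (Fin d))) :
    ℝ≥0∞ :=
  if p = 1 then (essInf (fun x => ENNReal.ofReal (ω x)) (volume.restrict B))⁻¹
  else (⨍⁻ x in B, ENNReal.ofReal (ω x) ^ (-(p / (p - 1))) ∂volume) ^ (1 / (p / (p - 1)))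

/-- Membership in the weight class `A^{ρ,θ}_{p,q}`, for `1 ≤ p < ∞` and `1 < q < ∞`. -/
def MemApq (ρ : EuclideanSpace ℝ (Fin d) → ℝ) (p q θ : ℝ)
    (ω : EuclideanSpace ℝ (Fin d) → ℝ) : Prop :=
  IsWeight ω ∧ ∃ C : ℝ, 0 < C ∧ ∀ (x₀ : EuclideanSpace ℝ (Fin d)) (r : ℝ), 0 < r →
    meanPow q ω (ball x₀ r) * dualMean p ω (ball x₀ r) ≤ ENNReal.ofReal C * growth ρ θ x₀ r

/-- The characteristic constant `[ω]` of the class `A^{ρ,θ}_{p,q}`. -/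
def apqConst (ρ : EuclideanSpace ℝ (Fin d) → ℝ) (p q θ : ℝ)
    (ω : EuclideanSpace ℝ (Fin d) → ℝ) : ℝ≥0∞ :=
  ⨆ (x₀ : EuclideanSpace ℝ (Fin d)) (r : ℝ) (_ : 0 < r),
    growth ρ (-θ) x₀ r * (meanPow q ω (ball x₀ r) * dualMean p ω (ball x₀ r))

/-- `|B| ^ (1/p - 1/q - β/d) (ω^p(B)) ^ (-1/p) (∫_B [f - ess inf_B f] ^ q ω ^ q) ^ (1/q)`
for `B = B(x₀, r)`. -/
def weightedMean (p q β : ℝ) (ω f : EuclideanSpace ℝ (Fin d) → ℝ)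
    (x₀ : EuclideanSpace ℝ (Fin d)) (r : ℝ) : ℝ≥0∞ :=
  volume (ball x₀ r) ^ (1 / p - 1 / q - β / d) /
      (∫⁻ x in ball x₀ r, ENNReal.ofReal (ω x) ^ p ∂volume) ^ (1 / p) *
    (∫⁻ x in ball x₀ r,
      lowerOsc f (ball x₀ r) x ^ q * ENNReal.ofReal (ω x) ^ q ∂volume) ^ (1 / q)

end SchrodingerCampanato

end

/-! Three facts carry the theorem: the slow variation of `ρ`, a duality inequality for the weights,
and a weight-free pointwise bound for `f`.

Critical radius. By Jensen, `RH_s` gives the reverse Hölder inequality with exponent `σ = d/2 > 1`.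
For this exponent `|B|^(1-1/σ)` is a multiple of `r^(d-2)`, so Hölder and reverse Hölder together
make `r^(2-d) ∫_B V` comparable to `(∫_B V^σ)^(1/σ)`. A thin annulus carries little of the mass of
`V`, hence `V` is doubling (`exists_doubling`). Comparability passes doubling to `V^σ`, and a
doubling measure on `ℝ^d` loses a fixed fraction of its mass when a ball is halved
(`exists_reverse_doubling`). The scaled mass therefore decays like a positive power of the radius,
even at the endpoint `s = d/2`. Growth and decay rates then compare `ρ(y)` with `ρ(x)`
(`critical_lower_bound`, `slowly_varying_of_lower_bound`).

Forward estimate. The averages of `f` over the balls `B(x, r/2^n)` exceed the average over `B(x, r)`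
by at most a geometric series. Lebesgue differentiation then gives, almost everywhere on `B`, `f -
ess inf_B f ≤ C |B|^(β/d) (1 + r/ρ(x₀))^((N₀+1)θ₁) ‖f‖` (`ae_lowerOsc_le`). This involves no weight,
so the constant does not depend on `p`, `q`, `ω`. It remains to integrate against `ω^q` and to use
`1 ≤ (⨍ω^p)^(1/p) · dualMean` (`MemApq.weightedMean_le`).

Converse. Writing `u = (uω) ω⁻¹` and applying Hölder bounds the mean of `f - ess inf_B f` by the
weighted mean times the `A_{p,q}` product (`MemApq.campanatoMean_le`). One factor `[ω]` comes from
this product and a second from the hypothesis, and the powers of `1 + r/ρ` add up to `θ₁`. -/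

namespace SchrodingerCampanato

/-! ### Variation of the critical radius from growth and decay of ball masses. -/

section CriticalRadius

/-- Iterated doubling gives polynomial growth. -/
theorem le_rpow_of_doubling {φ : ℝ → ℝ} {D : ℝ} (hD : 1 < D)
    (hmono : ∀ r R, 0 < r → r ≤ R → φ r ≤ φ R) (hφ : ∀ r, 0 < r → 0 < φ r)
    (hdbl : ∀ r, 0 < r → φ (2 * r) ≤ D * φ r) {t r : ℝ} (ht : 1 ≤ t) (hr : 0 < r) :
    φ (t * r) ≤ D * t ^ Real.logb 2 D * φ r := by
  have iter : ∀ n : ℕ, φ (2 ^ n * r) ≤ D ^ n * φ r := by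
    intro n
    induction n with
    | zero => simp
    | succ n ih =>
      calc φ (2 ^ (n + 1) * r) = φ (2 * (2 ^ n * r)) := by ring_nf
        _ ≤ D * φ (2 ^ n * r) := hdbl _ (by positivity)
        _ ≤ D * (D ^ n * φ r) := by gcongr
        _ = _ := by ring
  have ht0 : 0 < t := by linarith
  have hlog : 0 ≤ Real.logb 2 t := Real.logb_nonneg (by norm_num) ht
  set n := ⌈Real.logb 2 t⌉₊ with hn
  have h1 : t ≤ 2 ^ n := by
    rw [← Real.rpow_natCast, ← Real.logb_le_iff_le_rpow (by norm_num) ht0]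
    exact Nat.le_ceil _
  -- The leading factor `D` pays for rounding `log₂ t` up to an integer.
  have h2 : D ^ n ≤ D * t ^ Real.logb 2 D := by
    have : t ^ Real.logb 2 D = D ^ Real.logb 2 t := by
      rw [Real.rpow_def_of_pos ht0, Real.rpow_def_of_pos (by linarith), Real.logb, Real.logb]
      congr 1; ring
    rw [this, ← Real.rpow_natCast]
    nth_rw 2 [← Real.rpow_one D]
    rw [← Real.rpow_add (by linarith)]
    apply Real.rpow_le_rpow_of_exponent_le hD.le
    linarith [Nat.ceil_lt_add_one hlog]
  calc φ (t * r) ≤ φ (2 ^ n * r) := hmono _ _ (by positivity) (by gcongr)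
    _ ≤ D ^ n * φ r := iter n
    _ ≤ _ := by gcongr; exact (hφ r hr).le

/-- Iterated reverse doubling gives polynomial decay. -/
theorem le_rpow_of_reverse_doubling {φ : ℝ → ℝ} {η : ℝ} (hη : 0 < η) (hη1 : η < 1)
    (hmono : ∀ r R, 0 < r → r ≤ R → φ r ≤ φ R) (hφ : ∀ r, 0 < r → 0 < φ r)
    (hdbl : ∀ r, 0 < r → φ (r / 2) ≤ η * φ r) {r R : ℝ} (hr : 0 < r) (hR : r ≤ R) :
    φ r ≤ η⁻¹ * (r / R) ^ Real.logb 2 η⁻¹ * φ R := by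
  have iter : ∀ n : ℕ, φ (R / 2 ^ n) ≤ η ^ n * φ R := by
    intro n
    induction n with
    | zero => simp
    | succ n ih =>
      calc φ (R / 2 ^ (n + 1)) = φ (R / 2 ^ n / 2) := by rw [pow_succ, div_div]
        _ ≤ η * φ (R / 2 ^ n) := hdbl _ (div_pos (hr.trans_le hR) (by positivity))
        _ ≤ η * (η ^ n * φ R) := by gcongr
        _ = _ := by ring
  have hR0 : 0 < R := hr.trans_le hR
  have ht : 1 ≤ R / r := (one_le_div hr).2 hR
  have ht0 : 0 < R / r := by positivity
  have hlog : 0 ≤ Real.logb 2 (R / r) := Real.logb_nonneg (by norm_num) ht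
  set n := ⌊Real.logb 2 (R / r)⌋₊ with hn
  have h1 : r ≤ R / 2 ^ n := by
    rw [le_div_iff₀ (by positivity), mul_comm, ← le_div_iff₀ hr, ← Real.rpow_natCast,
      ← Real.le_logb_iff_rpow_le (by norm_num) ht0]
    exact Nat.floor_le hlog
  have h2 : η ^ n ≤ η⁻¹ * (r / R) ^ Real.logb 2 η⁻¹ := by
    have : (r / R) ^ Real.logb 2 η⁻¹ = η ^ Real.logb 2 (R / r) := by
      rw [Real.rpow_def_of_pos (by positivity), Real.rpow_def_of_pos hη, Real.logb, Real.logb,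
        ← inv_div R r, Real.log_inv, Real.log_inv]
      congr 1; ring
    rw [this, ← Real.rpow_natCast, ← Real.rpow_neg_one, ← Real.rpow_add hη]
    apply Real.rpow_le_rpow_of_exponent_ge hη hη1.le
    linarith [Nat.lt_floor_add_one (Real.logb 2 (R / r))]
  calc φ r ≤ φ (R / 2 ^ n) := hmono _ _ hr h1
    _ ≤ η ^ n * φ R := iter n
    _ ≤ _ := by gcongr; exact (hφ R hR0).le

variable {X : Type*} {N : X → ℝ → ℝ} {m : ℕ} {A δ : ℝ}

/-- Shrinking the radius by `λ` multiplies the scaled mass by at most `A λ^δ`. The choice `λ = (A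
K)^(-1/δ)` brings a bound `K` down to `1`, which produces lower bounds for the critical radius. -/
theorem scaled_mem_of_decay (hδ : 0 < δ) (hA : 1 ≤ A)
    (hdecay : ∀ x r R, 0 < r → r ≤ R →
      1 / r ^ m * N x r ≤ A * (r / R) ^ δ * (1 / R ^ m * N x R))
    {x : X} {R K : ℝ} (hR : 0 < R) (hK : 1 ≤ K) (h : 1 / R ^ m * N x R ≤ K) :
    R * (A * K) ^ (-(1 / δ)) ∈ {r : ℝ | 0 < r ∧ 1 / r ^ m * N x r ≤ 1} := by
  have hAK : 1 ≤ A * K := one_le_mul_of_one_le_of_one_le hA hK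
  have hAK0 : 0 < A * K := by linarith
  have hpos : 0 < (A * K) ^ (-(1 / δ)) := Real.rpow_pos_of_pos hAK0 _
  have hle : (A * K) ^ (-(1 / δ)) ≤ 1 :=
    Real.rpow_le_one_of_one_le_of_nonpos hAK (by simp [hδ.le])
  refine ⟨by positivity, (hdecay x _ R (by positivity) (mul_le_of_le_one_right hR.le hle)).trans ?_⟩
  rw [mul_div_cancel_left₀ _ hR.ne', ← Real.rpow_mul hAK0.le]
  have : -(1 / δ) * δ = -1 := by field_simp
  rw [this, Real.rpow_neg_one]
  calc A * (A * K)⁻¹ * (1 / R ^ m * N x R) ≤ A * (A * K)⁻¹ * K := by gcongr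
    _ = 1 := by field_simp

/-- Decay read backwards: for `r ≥ 1` the scaled mass is at least `r^δ N x 1 / A`, which exceeds `1`
for large `r`. Boundedness keeps the real `sSup` from taking its default value `0`. -/
theorem bddAbove_of_decay (hδ : 0 < δ) (hA : 1 ≤ A) (hpos : ∀ x r, 0 < r → 0 < N x r)
    (hdecay : ∀ x r R, 0 < r → r ≤ R →
      1 / r ^ m * N x r ≤ A * (r / R) ^ δ * (1 / R ^ m * N x R)) (x : X) :
    BddAbove {r : ℝ | 0 < r ∧ 1 / r ^ m * N x r ≤ 1} := by
  refine ⟨max 1 ((A / N x 1) ^ (1 / δ)), ?_⟩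
  rintro r ⟨hr, h⟩
  rcases le_total r 1 with h1 | h1
  · exact h1.trans (le_max_left _ _)
  refine le_trans ?_ (le_max_right _ _)
  have hN := hpos x 1 one_pos
  have hA0 : 0 < A := by linarith
  have h2 : N x 1 ≤ A * (1 / r) ^ δ := by
    have := hdecay x 1 r one_pos h1
    rw [one_pow, div_one, one_mul] at this
    refine this.trans ?_
    exact mul_le_of_le_one_right (by positivity) h
  rw [Real.div_rpow zero_le_one hr.le, Real.one_rpow, mul_one_div,
    le_div_iff₀ (by positivity), mul_comm, ← le_div_iff₀ hN] at h2
  calc r = (r ^ δ) ^ (1 / δ) := by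
        rw [← Real.rpow_mul hr.le, mul_one_div, div_self hδ.ne', Real.rpow_one]
    _ ≤ _ := by gcongr

theorem critical_pos_of_decay (hδ : 0 < δ) (hA : 1 ≤ A) (hpos : ∀ x r, 0 < r → 0 < N x r)
    (hdecay : ∀ x r R, 0 < r → r ≤ R →
      1 / r ^ m * N x r ≤ A * (r / R) ^ δ * (1 / R ^ m * N x R)) (x : X) :
    0 < sSup {r : ℝ | 0 < r ∧ 1 / r ^ m * N x r ≤ 1} := by
  have := scaled_mem_of_decay hδ hA hdecay (x := x) one_pos (le_max_left 1 _) (le_max_right _ _)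
  exact this.1.trans_le (le_csSup (bddAbove_of_decay hδ hA hpos hdecay x) this)

variable [PseudoMetricSpace X]

/-- With `t = dist x y / ρ x` and `R = (1 + t) ρ x`, the ball `B(y, R)` lies in `B(x, 2(1 + t) ρ
x)`. Polynomial growth bounds its scaled mass by a multiple of `(1 + t)^κ`, and shrinking `R` to
reach `1` costs the power `1/δ`. This is where the exponent `κ/δ` comes from. -/
theorem critical_lower_bound {κ D : ℝ} (hδ : 0 < δ) (hA : 1 ≤ A) (hκ : 0 < κ) (hD : 1 ≤ D)
    (hpos : ∀ x r, 0 < r → 0 < N x r)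
    (hmono : ∀ x y r R, 0 < r → r + dist x y ≤ R → N y r ≤ N x R)
    (hdecay : ∀ x r R, 0 < r → r ≤ R →
      1 / r ^ m * N x r ≤ A * (r / R) ^ δ * (1 / R ^ m * N x R))
    (hgrow : ∀ x t r, 1 ≤ t → 0 < r → N x (t * r) ≤ D * t ^ κ * N x r) {ρ : X → ℝ}
    (hρ : ∀ x, ρ x = sSup {r : ℝ | 0 < r ∧ 1 / r ^ m * N x r ≤ 1}) (x y : X) :
    1 / (A * (D * 4 ^ κ * A)) ^ (1 / δ) * (1 + dist x y / ρ x) ^ (-(κ / δ)) ≤ ρ y / ρ x := by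
  have hρ0 : 0 < ρ x := by rw [hρ]; exact critical_pos_of_decay hδ hA hpos hdecay x
  have hA0 : 0 < A := by linarith
  have hD0 : 0 < D := by linarith
  set t := dist x y / ρ x with ht
  have ht0 : 0 ≤ t := by positivity
  have htd : dist x y = t * ρ x := by rw [ht]; field_simp
  -- The scaled mass need not be monotone in the radius, so `ρ x / 2` may fail to belong to the
  -- defining set. A larger member and the decay inequality still give the bound `A`.
  have h1 : N x (ρ x / 2) ≤ A * (ρ x / 2) ^ m := by
    have hlt : ρ x / 2 < sSup {r : ℝ | 0 < r ∧ 1 / r ^ m * N x r ≤ 1} := by rw [← hρ]; linarith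
    have hne : {r : ℝ | 0 < r ∧ 1 / r ^ m * N x r ≤ 1}.Nonempty :=
      ⟨_, scaled_mem_of_decay hδ hA hdecay (x := x) one_pos (le_max_left 1 _) (le_max_right _ _)⟩
    obtain ⟨r, ⟨hr, h⟩, hlr⟩ := exists_lt_of_lt_csSup hne hlt
    have h2 := hdecay x (ρ x / 2) r (by positivity) hlr.le
    have h3 : (ρ x / 2 / r) ^ δ ≤ 1 :=
      Real.rpow_le_one (by positivity) ((div_le_one hr).2 hlr.le) hδ.le
    have h4 : A * (ρ x / 2 / r) ^ δ * (1 / r ^ m * N x r) ≤ A := by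
      calc A * (ρ x / 2 / r) ^ δ * (1 / r ^ m * N x r) ≤ A * 1 * 1 := by
            have := hpos x r hr
            gcongr
        _ = A := by ring
    have h5 := h2.trans h4
    rwa [one_div, inv_mul_le_iff₀ (by positivity), mul_comm] at h5
  set R := (1 + t) * ρ x with hRdef
  have hR0 : 0 < R := by positivity
  set K := D * 4 ^ κ * A * (1 + t) ^ κ with hK
  have h4κ : (1:ℝ) ≤ 4 ^ κ := Real.one_le_rpow (by norm_num) hκ.le
  have hDA : 1 ≤ D * 4 ^ κ * A :=
    one_le_mul_of_one_le_of_one_le (one_le_mul_of_one_le_of_one_le hD h4κ) hA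
  have hK1 : 1 ≤ K :=
    one_le_mul_of_one_le_of_one_le hDA (Real.one_le_rpow (by linarith) hκ.le)
  have h2 : 1 / R ^ m * N y R ≤ K := by
    rw [one_div, inv_mul_le_iff₀ (by positivity)]
    calc N y R ≤ N x (4 * (1 + t) * (ρ x / 2)) := by
          apply hmono _ _ _ _ hR0
          rw [htd, hRdef]
          nlinarith
      _ ≤ D * (4 * (1 + t)) ^ κ * N x (ρ x / 2) := hgrow _ _ _ (by linarith) (by positivity)
      _ ≤ D * (4 * (1 + t)) ^ κ * (A * (ρ x / 2) ^ m) := by gcongr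
      _ ≤ D * (4 * (1 + t)) ^ κ * (A * R ^ m) := by
          gcongr
          rw [hRdef]; nlinarith
      _ = R ^ m * K := by rw [Real.mul_rpow (by norm_num) (by linarith), hK]; ring
  have h3 := le_csSup (bddAbove_of_decay hδ hA hpos hdecay y)
    (scaled_mem_of_decay hδ hA hdecay hR0 hK1 h2)
  rw [← hρ] at h3
  rw [le_div_iff₀ hρ0]
  refine le_trans (le_of_eq ?_) ((mul_le_mul_of_nonneg_right (?_ : ρ x ≤ R)
    (by positivity : 0 ≤ (A * K) ^ (-(1 / δ)))).trans h3)
  · rw [hK, ← mul_assoc A (_ * A), Real.mul_rpow (x := A * (D * 4 ^ κ * A)) (by positivity) (by positivity),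
      ← Real.rpow_mul (by linarith), Real.rpow_neg (x := A * (D * 4 ^ κ * A)) (by positivity)]
    have : κ * -(1 / δ) = -(κ / δ) := by ring
    rw [this]; ring
  · rw [hRdef]; nlinarith

/-- The upper bound for the variation of `ρ` is a consequence of the lower bound. -/
theorem slowly_varying_of_lower_bound {ρ : X → ℝ} (hρ : ∀ x, 0 < ρ x) {C₁ N₀ : ℝ} (hC : 1 ≤ C₁)
    (hN : 0 < N₀)
    (h : ∀ x y, 1 / C₁ * (1 + dist x y / ρ x) ^ (-N₀) ≤ ρ y / ρ x) (x y : X) :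
    ρ y / ρ x ≤ (C₁ * 2 ^ N₀) * (1 + dist x y / ρ x) ^ (N₀ / (N₀ + 1)) := by
  have hx := hρ x
  have hy := hρ y
  have hC0 : 0 < C₁ := by linarith
  set u := ρ y / ρ x with hu
  set t := dist x y / ρ x with ht
  have hu0 : 0 < u := by positivity
  have ht0 : 0 ≤ t := by positivity
  have h2N : (1:ℝ) ≤ 2 ^ N₀ := Real.one_le_rpow (by norm_num) hN.le
  have hC2 : 1 ≤ C₁ * 2 ^ N₀ := one_le_mul_of_one_le_of_one_le hC h2N
  have hexp : 0 ≤ N₀ / (N₀ + 1) := by positivity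
  -- This is the lower bound with `x` and `y` exchanged, since `dist y x / ρ y = t / u`. If `t ≤ u`
  -- the right side is a constant; otherwise it is at most `C₁ (2t/u)^N₀`, and solving for `u` gives
  -- the exponent `N₀/(N₀+1)`.
  have h1 : u ≤ C₁ * (1 + t / u) ^ N₀ := by
    have := h y x
    have e1 : dist y x / ρ y = t / u := by rw [ht, hu, dist_comm]; field_simp
    have e2 : ρ x / ρ y = u⁻¹ := by rw [hu]; field_simp
    rw [e1, e2, Real.rpow_neg (by positivity), one_div, ← mul_inv] at this
    exact (inv_le_inv₀ (by positivity) hu0).1 this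
  rcases le_total t u with htu | htu
  · calc u ≤ C₁ * (1 + t / u) ^ N₀ := h1
      _ ≤ C₁ * 2 ^ N₀ := by
          gcongr
          have := (div_le_one hu0).2 htu
          linarith
      _ ≤ _ := le_mul_of_one_le_right (by positivity) (Real.one_le_rpow (by linarith) hexp)
  · have h2 : u ≤ C₁ * (2 * (t / u)) ^ N₀ := by
      refine h1.trans ?_
      gcongr
      have := (one_le_div hu0).2 htu
      linarith
    have h3 : u ^ (N₀ + 1) ≤ C₁ * 2 ^ N₀ * t ^ N₀ := by
      rw [Real.mul_rpow (by norm_num) (by positivity), Real.div_rpow ht0 hu0.le] at h2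
      rw [Real.rpow_add_one hu0.ne', mul_comm]
      calc u * u ^ N₀ ≤ C₁ * (2 ^ N₀ * (t ^ N₀ / u ^ N₀)) * u ^ N₀ := by gcongr
        _ = _ := by field_simp
    calc u = (u ^ (N₀ + 1)) ^ (1 / (N₀ + 1)) := by
          rw [← Real.rpow_mul hu0.le, mul_one_div, div_self (by positivity), Real.rpow_one]
      _ ≤ (C₁ * 2 ^ N₀ * t ^ N₀) ^ (1 / (N₀ + 1)) := by gcongr
      _ = (C₁ * 2 ^ N₀) ^ (1 / (N₀ + 1)) * t ^ (N₀ / (N₀ + 1)) := by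
          rw [Real.mul_rpow (by positivity) (by positivity), ← Real.rpow_mul ht0, mul_one_div]
      _ ≤ (C₁ * 2 ^ N₀) ^ (1:ℝ) * (1 + t) ^ (N₀ / (N₀ + 1)) := by
          gcongr
          · rw [div_le_one (by positivity)]; linarith
          · linarith
      _ = _ := by rw [Real.rpow_one]

end CriticalRadius

/-! ### Doubling and reverse doubling; `N` and `M` stand for the ball masses of `V` and `V^σ`. -/

section BallFunctions

variable {X : Type*} [PseudoMetricSpace X] {N M : X → ℝ → ℝ} {d : ℕ} {v e τ C D : ℝ}

theorem exists_dilation_close_to_one (he : 0 < e) (C : ℝ) (d : ℕ) :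
    ∃ l : ℝ, 1 < l ∧ C * ((l ^ d - 1) / l ^ d) ^ e ≤ 1 / 2 := by
  have hcont : ContinuousAt (fun l : ℝ => C * ((l ^ d - 1) / l ^ d) ^ e) 1 := by
    refine continuousAt_const.mul (ContinuousAt.rpow_const ?_ (Or.inr he.le))
    exact ContinuousAt.div (by fun_prop) (by fun_prop) (by simp)
  have h0 : C * (((1:ℝ) ^ d - 1) / 1 ^ d) ^ e < 1 / 2 := by
    simp [Real.zero_rpow he.ne']
  have h1 := hcont.eventually_lt continuousAt_const h0
  obtain ⟨l, hl, hl1⟩ := ((h1.filter_mono nhdsWithin_le_nhds).and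
    (self_mem_nhdsWithin : Set.Ioi (1:ℝ) ∈ nhdsWithin 1 (Set.Ioi 1))).exists
  exact ⟨l, hl1, hl.le⟩

theorem rpow_neg_mul_rpow_of_scaled (hv : 0 < v) {a b : ℝ} (ha : 0 ≤ a) (hb : 0 < b) :
    (v * b) ^ (-e) * (v * a) ^ e = (a / b) ^ e := by
  rw [Real.rpow_neg (by positivity), inv_mul_eq_div, ← Real.div_rpow (by positivity) (by positivity),
    mul_div_mul_left _ _ hv.ne']

/-- The reverse Hölder inequality implies doubling. -/
theorem exists_doubling (hv : 0 < v) (he : 0 < e)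
    (hmono : ∀ x y r R, 0 < r → r + dist x y ≤ R → N y r ≤ N x R)
    (hN : ∀ x r, 0 ≤ N x r)
    (hhold : ∀ x r R, 0 ≤ r → r ≤ R → N x R - N x r ≤ M x R ^ τ * (v * (R ^ d - r ^ d)) ^ e)
    (hrev : ∀ x r, 0 < r → M x r ^ τ ≤ C * (v * r ^ d) ^ (-e) * N x r) :
    ∃ D : ℝ, 1 < D ∧ ∀ x r, 0 < r → N x (2 * r) ≤ D * N x r := by
  obtain ⟨l, hl, hCl⟩ := exists_dilation_close_to_one he C d
  have hl0 : 0 < l := by linarith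
  have step : ∀ x r, 0 < r → N x (l * r) ≤ 2 * N x r := by
    intro x r hr
    have h1 := hhold x r (l * r) hr.le (by nlinarith)
    have h2 := hrev x (l * r) (by positivity)
    have h3 : 0 ≤ (l * r) ^ d - r ^ d :=
      sub_nonneg.2 (pow_le_pow_left₀ hr.le (by nlinarith) d)
    -- By the choice of `l` the annulus carries at most half of the mass of the larger ball, so its
    -- mass can be absorbed.
    have h4 : N x (l * r) - N x r ≤ 1 / 2 * N x (l * r) := by
      calc N x (l * r) - N x r ≤ M x (l * r) ^ τ * (v * ((l * r) ^ d - r ^ d)) ^ e := h1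
        _ ≤ (C * (v * (l * r) ^ d) ^ (-e) * N x (l * r)) * (v * ((l * r) ^ d - r ^ d)) ^ e := by
            gcongr
        _ = C * ((v * (l * r) ^ d) ^ (-e) * (v * ((l * r) ^ d - r ^ d)) ^ e) * N x (l * r) := by
            ring
        _ = C * ((l ^ d - 1) / l ^ d) ^ e * N x (l * r) := by
            rw [rpow_neg_mul_rpow_of_scaled hv h3 (by positivity)]
            congr 3
            rw [mul_pow]
            field_simp
        _ ≤ _ := by gcongr; exact hN _ _
    linarith
  have iter : ∀ n : ℕ, ∀ x r, 0 < r → N x (l ^ n * r) ≤ 2 ^ n * N x r := by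
    intro n x r hr
    induction n with
    | zero => simp
    | succ n ih =>
      calc N x (l ^ (n + 1) * r) = N x (l * (l ^ n * r)) := by ring_nf
        _ ≤ 2 * N x (l ^ n * r) := step _ _ (by positivity)
        _ ≤ 2 * (2 ^ n * N x r) := by gcongr
        _ = _ := by ring
  obtain ⟨n, hn⟩ := pow_unbounded_of_one_lt 2 hl
  refine ⟨2 ^ (n + 1), one_lt_pow₀ (by norm_num) (by omega), fun x r hr => ?_⟩
  calc N x (2 * r) ≤ N x (l ^ n * r) := hmono _ _ _ _ (by positivity) (by rw [dist_self]; nlinarith)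
    _ ≤ 2 ^ n * N x r := iter n x r hr
    _ ≤ _ := by gcongr; exacts [hN _ _, by norm_num, by omega]

theorem pos_of_doubling (hD : 1 < D)
    (hmono : ∀ x y r R, 0 < r → r + dist x y ≤ R → N y r ≤ N x R)
    (hN : ∀ x r, 0 ≤ N x r) (hne : ∀ x, ∃ R, 0 < R ∧ 0 < N x R)
    (hdbl : ∀ x r, 0 < r → N x (2 * r) ≤ D * N x r) (x : X) {r : ℝ} (hr : 0 < r) : 0 < N x r := by
  have iter : ∀ n : ℕ, N x (2 ^ n * r) ≤ D ^ n * N x r := by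
    intro n
    induction n with
    | zero => simp
    | succ n ih =>
      calc N x (2 ^ (n + 1) * r) = N x (2 * (2 ^ n * r)) := by ring_nf
        _ ≤ D * N x (2 ^ n * r) := hdbl _ _ (by positivity)
        _ ≤ D * (D ^ n * N x r) := by gcongr
        _ = _ := by ring
  obtain ⟨R, hR, hNR⟩ := hne x
  obtain ⟨n, hn⟩ := pow_unbounded_of_one_lt (R / r) one_lt_two
  rw [div_lt_iff₀ hr] at hn
  have h := (hmono x x R _ hR (by rw [dist_self]; linarith)).trans (iter n)
  by_contra h0
  have h1 : N x r = 0 := le_antisymm (not_lt.1 h0) (hN _ _)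
  rw [h1, mul_zero] at h
  linarith

/-- The measure `V ^ σ` decays on concentric balls, because it is doubling as well. -/
theorem exists_reverse_doubling (hv : 0 < v) (he : 0 < e) (hτ : 0 < τ) (hC : 0 < C)
    (hmonoM : ∀ x y r R, 0 < r → r + dist x y ≤ R → M y r ≤ M x R)
    (hposM : ∀ x r, 0 < r → 0 < M x r)
    (hhold : ∀ x r, 0 < r → N x r ≤ M x r ^ τ * (v * r ^ d) ^ e)
    (hrev : ∀ x r, 0 < r → M x r ^ τ ≤ C * (v * r ^ d) ^ (-e) * N x r)
    (hD : 1 < D) (hdbl : ∀ x r, 0 < r → N x (2 * r) ≤ D * N x r)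
    (hann : ∀ x r, 0 < r → ∃ y, dist y x ≤ 3 / 4 * r ∧ M x (r / 2) + M y (r / 4) ≤ M x r) :
    ∃ η : ℝ, 0 < η ∧ η < 1 ∧ ∀ x r, 0 < r → M x (r / 2) ≤ η * M x r := by
  have h8 : ∀ x r, 0 < r → N x (8 * r) ≤ D ^ 3 * N x r := by
    intro x r hr
    calc N x (8 * r) = N x (2 * (2 * (2 * r))) := by ring_nf
      _ ≤ D * (D * (D * N x r)) := by
          refine (hdbl _ _ (by positivity)).trans ?_
          gcongr
          refine (hdbl _ _ (by positivity)).trans ?_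
          gcongr
          exact hdbl _ _ hr
      _ = _ := by ring
  have hM8 : ∀ x r, 0 < r → M x (8 * r) ^ τ ≤ C * D ^ 3 * M x r ^ τ := by
    intro x r hr
    have hMr := hposM x r hr
    calc M x (8 * r) ^ τ ≤ C * (v * (8 * r) ^ d) ^ (-e) * N x (8 * r) := hrev _ _ (by positivity)
      _ ≤ C * (v * (8 * r) ^ d) ^ (-e) * (D ^ 3 * (M x r ^ τ * (v * r ^ d) ^ e)) := by
          gcongr
          refine (h8 x r hr).trans ?_
          gcongr
          exact hhold x r hr
      _ = C * D ^ 3 * M x r ^ τ * ((v * (8 * r) ^ d) ^ (-e) * (v * r ^ d) ^ e) := by ring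
      _ ≤ C * D ^ 3 * M x r ^ τ * 1 := by
          rw [rpow_neg_mul_rpow_of_scaled hv (by positivity) (by positivity)]
          gcongr
          apply Real.rpow_le_one (by positivity) _ he.le
          rw [div_le_one (by positivity)]
          gcongr
          linarith
      _ = _ := mul_one _
  -- `T` is a constant for dilating `M` by `8`; the maximum with `2` makes `1 - 1/T` positive.
  set T := max 2 ((C * D ^ 3) ^ (1 / τ)) with hT
  have hT0 : 0 < T := lt_of_lt_of_le two_pos (le_max_left _ _)
  have hT1 : 1 < T := lt_of_lt_of_le one_lt_two (le_max_left _ _)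
  have hMT : ∀ x r, 0 < r → M x (8 * r) ≤ T * M x r := by
    intro x r hr
    have hMr := hposM x r hr
    have hM8r := hposM x (8 * r) (by positivity)
    have hD0 : 0 < D := by linarith
    have h := Real.rpow_le_rpow (by positivity) (hM8 x r hr) (by positivity : 0 ≤ 1 / τ)
    rw [Real.mul_rpow (by positivity) (by positivity), ← Real.rpow_mul hM8r.le,
      ← Real.rpow_mul hMr.le, mul_one_div, div_self hτ.ne', Real.rpow_one, Real.rpow_one] at h
    exact h.trans (by gcongr; exact le_max_right _ _)
  refine ⟨1 - 1 / T, ?_, ?_, fun x r hr => ?_⟩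
  · rw [sub_pos, div_lt_one hT0]; exact hT1
  · rw [sub_lt_self_iff]; positivity
  · obtain ⟨y, hy, hM⟩ := hann x r hr
    -- `B(x, r) ⊆ B(y, 2r)`, and `2r` is `8` times `r/4`. The small ball at `y` thus holds a
    -- fraction `1/T` of the mass, which is missing from `B(x, r/2)`.
    have h1 : M x r ≤ T * M y (r / 4) :=
      (hmonoM y x r (8 * (r / 4)) hr (by linarith)).trans (hMT y _ (by positivity))
    have h2 : 1 / T * M x r ≤ M y (r / 4) := by
      rw [one_div, inv_mul_le_iff₀ hT0]; exact h1
    linarith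

/-- The relation `d e = m` makes `|B|^e` a multiple of `r^m`, so `N x r / r^m` and `M x r ^ τ` are
comparable. The decay of `M` becomes decay of the scaled mass with `δ = τ log₂(1/η)`, and doubling
of `N` supplies `κ = log₂ D`. -/
theorem exists_slowly_varying_of_reverse_holder {m : ℕ} (hd : d ≠ 0) (hv : 0 < v) (he : 0 < e)
    (hem : (d : ℝ) * e = m) (hτ : 0 < τ) (hC : 0 < C)
    (hmono : ∀ x y r R, 0 < r → r + dist x y ≤ R → N y r ≤ N x R)
    (hmonoM : ∀ x y r R, 0 < r → r + dist x y ≤ R → M y r ≤ M x R)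
    (hN : ∀ x r, 0 ≤ N x r) (hM : ∀ x r, 0 ≤ M x r) (hN0 : ∀ x, N x 0 = 0)
    (hne : ∀ x, ∃ R, 0 < R ∧ 0 < N x R)
    (hhold : ∀ x r R, 0 ≤ r → r ≤ R → N x R - N x r ≤ M x R ^ τ * (v * (R ^ d - r ^ d)) ^ e)
    (hrev : ∀ x r, 0 < r → M x r ^ τ ≤ C * (v * r ^ d) ^ (-e) * N x r)
    (hann : ∀ x r, 0 < r → ∃ y, dist y x ≤ 3 / 4 * r ∧ M x (r / 2) + M y (r / 4) ≤ M x r)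
    {ρ : X → ℝ} (hρ : ∀ x, ρ x = sSup {r : ℝ | 0 < r ∧ 1 / r ^ m * N x r ≤ 1}) :
    (∀ x, 0 < ρ x) ∧ ∃ C₀ N₀ : ℝ, 1 ≤ C₀ ∧ 0 < N₀ ∧ ∀ x y,
      1 / C₀ * (1 + dist x y / ρ x) ^ (-N₀) ≤ ρ y / ρ x ∧
      ρ y / ρ x ≤ C₀ * (1 + dist x y / ρ x) ^ (N₀ / (N₀ + 1)) := by
  obtain ⟨D, hD, hdbl⟩ := exists_doubling hv he hmono hN hhold hrev
  have hpos : ∀ x r, 0 < r → 0 < N x r := fun x r hr => pos_of_doubling hD hmono hN hne hdbl x hr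
  have hhold0 : ∀ x r, 0 < r → N x r ≤ M x r ^ τ * (v * r ^ d) ^ e := by
    intro x r hr
    simpa [hN0, hd] using hhold x 0 r le_rfl hr.le
  have hposM : ∀ x r, 0 < r → 0 < M x r := by
    intro x r hr
    refine lt_of_le_of_ne (hM x r) fun h => ?_
    have := hhold0 x r hr
    rw [← h, Real.zero_rpow hτ.ne', zero_mul] at this
    linarith [hpos x r hr]
  obtain ⟨η, hη, hη1, hhalf⟩ := exists_reverse_doubling hv he hτ hC hmonoM hposM hhold0
    hrev hD hdbl hann
  set δ := Real.logb 2 η⁻¹ * τ with hδdef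
  have hδ : 0 < δ := mul_pos (Real.logb_pos one_lt_two ((one_lt_inv₀ hη).2 hη1)) hτ
  set A := max 1 (C * η⁻¹ ^ τ) with hAdef
  have hA : 1 ≤ A := le_max_left _ _
  have hvol : ∀ r, 0 < r → (v * r ^ d) ^ e = v ^ e * r ^ m := by
    intro r hr
    rw [Real.mul_rpow hv.le (by positivity), ← Real.rpow_natCast, ← Real.rpow_mul hr.le, hem,
      Real.rpow_natCast]
  have hdecay : ∀ x r R, 0 < r → r ≤ R →
      1 / r ^ m * N x r ≤ A * (r / R) ^ δ * (1 / R ^ m * N x R) := by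
    intro x r R hr hR
    have hR0 : 0 < R := hr.trans_le hR
    have hMR := hposM x R hR0
    have hMr := hposM x r hr
    have hNR := hpos x R hR0
    have h1 : M x r ≤ η⁻¹ * (r / R) ^ Real.logb 2 η⁻¹ * M x R :=
      le_rpow_of_reverse_doubling hη hη1
        (fun a b ha hab => hmonoM x x a b ha (by simpa using hab)) (hposM x) (hhalf x) hr hR
    have h2 : M x r ^ τ ≤ η⁻¹ ^ τ * (r / R) ^ δ * M x R ^ τ := by
      refine (Real.rpow_le_rpow hMr.le h1 hτ.le).trans (le_of_eq ?_)
      rw [Real.mul_rpow (by positivity) hMR.le, Real.mul_rpow (by positivity) (by positivity),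
        ← Real.rpow_mul (by positivity)]
    calc 1 / r ^ m * N x r ≤ 1 / r ^ m * (M x r ^ τ * (v ^ e * r ^ m)) := by
          rw [← hvol r hr]; gcongr; exact hhold0 x r hr
      _ = v ^ e * M x r ^ τ := by field_simp
      _ ≤ v ^ e * (η⁻¹ ^ τ * (r / R) ^ δ * (C * (v * R ^ d) ^ (-e) * N x R)) := by
          gcongr
          refine h2.trans ?_
          gcongr
          exact hrev x R hR0
      _ = (C * η⁻¹ ^ τ) * (r / R) ^ δ * (1 / R ^ m * N x R) := by
          rw [Real.rpow_neg (by positivity), hvol R hR0]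
          field_simp
      _ ≤ _ := by gcongr; exact le_max_right _ _
  have hρ0 : ∀ x, 0 < ρ x := fun x => by
    rw [hρ]; exact critical_pos_of_decay hδ hA hpos hdecay x
  have hκ : 0 < Real.logb 2 D := Real.logb_pos one_lt_two hD
  set κ := Real.logb 2 D with hκdef
  have hlow := critical_lower_bound hδ hA hκ hD.le hpos hmono hdecay
    (fun x t r ht hr => le_rpow_of_doubling hD
      (fun a b ha hab => hmono x x a b ha (by simpa using hab)) (hpos x) (hdbl x) ht hr) hρ
  have hD0 : 0 < D := by linarith
  have h4κ : (1:ℝ) ≤ 4 ^ κ := Real.one_le_rpow (by norm_num) hκ.le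
  have hB : 1 ≤ (A * (D * 4 ^ κ * A)) ^ (1 / δ) := by
    refine Real.one_le_rpow (one_le_mul_of_one_le_of_one_le hA
      (one_le_mul_of_one_le_of_one_le (one_le_mul_of_one_le_of_one_le hD.le h4κ) hA)) (by positivity)
  set B := (A * (D * 4 ^ κ * A)) ^ (1 / δ) with hBdef
  have hN1 : 0 < κ / δ := by positivity
  have h2N : (1:ℝ) ≤ 2 ^ (κ / δ) := Real.one_le_rpow (by norm_num) hN1.le
  have hup := slowly_varying_of_lower_bound hρ0 hB hN1 hlow
  refine ⟨hρ0, B * 2 ^ (κ / δ), κ / δ, one_le_mul_of_one_le_of_one_le hB h2N, hN1, fun x y =>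
    ⟨le_trans ?_ (hlow x y), hup x y⟩⟩
  have := hρ0 x
  gcongr
  exact le_mul_of_one_le_right (by linarith) h2N

end BallFunctions

/-! ### Jensen and Hölder inequalities for averages. -/

section Averages

variable {α : Type*} [MeasurableSpace α] {μ : Measure α} {f : α → ℝ≥0∞}

theorem lintegral_rpow_le_lintegral_rpow [IsProbabilityMeasure μ] (hf : AEMeasurable f μ) {p q : ℝ}
    (hp : 0 < p) (hpq : p ≤ q) :
    (∫⁻ x, f x ^ p ∂μ) ^ (1 / p) ≤ (∫⁻ x, f x ^ q ∂μ) ^ (1 / q) := by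
  simpa [eLpNorm'] using
    eLpNorm'_le_eLpNorm'_mul_rpow_measure_univ hp hpq hf.aestronglyMeasurable

theorem laverage_rpow_le_laverage_rpow [IsFiniteMeasure μ] [NeZero μ] (hf : AEMeasurable f μ)
    {p q : ℝ} (hp : 0 < p) (hpq : p ≤ q) :
    (⨍⁻ x, f x ^ p ∂μ) ^ (1 / p) ≤ (⨍⁻ x, f x ^ q ∂μ) ^ (1 / q) :=
  lintegral_rpow_le_lintegral_rpow (hf.smul_measure _) hp hpq

theorem laverage_rpow_le_of_ae_le [IsFiniteMeasure μ] [NeZero μ] {c : ℝ≥0∞} {p : ℝ} (hp : 0 < p)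
    (h : ∀ᵐ x ∂μ, f x ≤ c) : (⨍⁻ x, f x ^ p ∂μ) ^ (1 / p) ≤ c := by
  have h1 : ⨍⁻ x, f x ^ p ∂μ ≤ c ^ p := by
    rw [← laverage_const μ (c ^ p)]
    apply laverage_mono_ae
    filter_upwards [h] with x hx
    exact ENNReal.rpow_le_rpow hx hp.le
  calc (⨍⁻ x, f x ^ p ∂μ) ^ (1 / p) ≤ (c ^ p) ^ (1 / p) := by gcongr
    _ = c := by rw [← ENNReal.rpow_mul, mul_one_div, div_self hp.ne', ENNReal.rpow_one]

/-- Hölder's inequality on a set, against the constant function. -/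
theorem setLIntegral_le_rpow_mul_measure_rpow {s : Set α} (hf : AEMeasurable f (μ.restrict s))
    {p : ℝ} (hp : 1 < p) :
    ∫⁻ x in s, f x ∂μ ≤ (∫⁻ x in s, f x ^ p ∂μ) ^ (1 / p) * μ s ^ (1 - 1 / p) := by
  have hpq := Real.HolderConjugate.conjExponent hp
  have h := ENNReal.lintegral_mul_le_Lp_mul_Lq (μ.restrict s) hpq hf
    (aemeasurable_const (b := (1 : ℝ≥0∞)))
  have he : 1 / p.conjExponent = 1 - 1 / p := by
    have := hpq.inv_add_inv_eq_one
    simp only [one_div]; linarith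
  simpa [he] using h

end Averages

variable {d : ℕ}

/-- The volume of the unit ball. -/
noncomputable def unitVolume (d : ℕ) : ℝ := (volume (ball (0 : EuclideanSpace ℝ (Fin d)) 1)).toReal

theorem unitVolume_pos (d : ℕ) : 0 < unitVolume d :=
  ENNReal.toReal_pos (measure_ball_pos _ _ one_pos).ne' measure_ball_lt_top.ne

theorem volume_ball_eq (hd : d ≠ 0) (x : EuclideanSpace ℝ (Fin d)) {r : ℝ} (hr : 0 ≤ r) :
    volume (ball x r) = ENNReal.ofReal (unitVolume d * r ^ d) := by
  have : Nonempty (Fin d) := ⟨⟨0, Nat.pos_of_ne_zero hd⟩⟩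
  rw [Measure.addHaar_ball volume x hr, unitVolume, ENNReal.ofReal_mul (by positivity),
    ENNReal.ofReal_toReal measure_ball_lt_top.ne, mul_comm, finrank_euclideanSpace,
    Fintype.card_fin]

theorem neZero_restrict_ball (x : EuclideanSpace ℝ (Fin d)) {r : ℝ} (hr : 0 < r) :
    NeZero ((volume : Measure (EuclideanSpace ℝ (Fin d))).restrict (ball x r)) :=
  ⟨by rw [Ne, Measure.restrict_eq_zero]; exact (measure_ball_pos _ _ hr).ne'⟩

instance isFiniteMeasure_restrict_ball (x : EuclideanSpace ℝ (Fin d)) (r : ℝ) :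
    IsFiniteMeasure ((volume : Measure (EuclideanSpace ℝ (Fin d))).restrict (ball x r)) :=
  isFiniteMeasure_restrict.2 measure_ball_lt_top.ne

theorem setLIntegral_ball_eq_volume_mul_laverage (f : (EuclideanSpace ℝ (Fin d)) → ℝ≥0∞) (x : EuclideanSpace ℝ (Fin d)) (r : ℝ) :
    ∫⁻ y in ball x r, f y = volume (ball x r) * ⨍⁻ y in ball x r, f y ∂volume := by
  rw [← measure_mul_laverage, Measure.restrict_apply_univ]

theorem laverage_ball_eq (f : (EuclideanSpace ℝ (Fin d)) → ℝ≥0∞) (x : EuclideanSpace ℝ (Fin d)) (r : ℝ) :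
    ⨍⁻ y in ball x r, f y ∂volume = (volume (ball x r))⁻¹ * ∫⁻ y in ball x r, f y := by
  rw [laverage_eq, Measure.restrict_apply_univ, ENNReal.div_eq_inv_mul]

/-! ### Reverse Hölder potentials satisfy the ball-mass hypotheses. -/

section ReverseHolder

variable {s : ℝ≥0∞} {V : (EuclideanSpace ℝ (Fin d)) → ℝ}

theorem ReverseHolder.exists_bound_half_dim (hV : ReverseHolder s V) (hd : d ≠ 0)
    (hs : (d : ℝ≥0∞) / 2 ≤ s) :
    ∃ C : ℝ, 0 < C ∧ ∀ (x : EuclideanSpace ℝ (Fin d)) (r : ℝ), 0 < r →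
      (⨍⁻ y in ball x r, ENNReal.ofReal (V y) ^ ((d : ℝ) / 2) ∂volume) ^ (1 / ((d : ℝ) / 2))
        ≤ ENNReal.ofReal C * ⨍⁻ y in ball x r, ENNReal.ofReal (V y) ∂volume := by
  obtain ⟨C, hC, h⟩ := hV.bound
  have hd0 : (0 : ℝ) < d / 2 := by positivity
  have hmeas : AEMeasurable (fun y => ENNReal.ofReal (V y)) volume :=
    hV.locallyIntegrable.aestronglyMeasurable.aemeasurable.ennreal_ofReal
  refine ⟨C, hC, fun x r hr => le_trans ?_ (h x r hr)⟩
  have := neZero_restrict_ball x hr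
  split_ifs with htop
  · exact laverage_rpow_le_of_ae_le hd0 (ENNReal.ae_le_essSup _)
  · apply laverage_rpow_le_laverage_rpow hmeas.restrict hd0
    have := ENNReal.toReal_mono htop hs
    simpa [ENNReal.toReal_div] using this

theorem ReverseHolder.integrableOn_ball (hV : ReverseHolder s V) (x : EuclideanSpace ℝ (Fin d)) (r : ℝ) :
    IntegrableOn V (ball x r) :=
  (hV.locallyIntegrable.integrableOn_isCompact (isCompact_closedBall x r)).mono_set
    ball_subset_closedBall

theorem ReverseHolder.setIntegral_eq (hV : ReverseHolder s V) {S : Set (EuclideanSpace ℝ (Fin d))} (x : EuclideanSpace ℝ (Fin d)) (r : ℝ)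
    (hS : S ⊆ ball x r) :
    ∫ y in S, V y = (∫⁻ y in S, ENNReal.ofReal (V y)).toReal :=
  integral_eq_lintegral_of_nonneg_ae (ae_of_all _ hV.nonneg)
    ((hV.integrableOn_ball x r).mono_set hS).aestronglyMeasurable

theorem ReverseHolder.setLIntegral_ne_top (hV : ReverseHolder s V) (x : EuclideanSpace ℝ (Fin d)) (r : ℝ) :
    ∫⁻ y in ball x r, ENNReal.ofReal (V y) ≠ ∞ :=
  (hV.integrableOn_ball x r).lintegral_lt_top.ne

theorem exists_volume_add_le (hd : d ≠ 0) (f : (EuclideanSpace ℝ (Fin d)) → ℝ≥0∞) (x : EuclideanSpace ℝ (Fin d)) {r : ℝ} (hr : 0 < r) :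
    ∃ y : EuclideanSpace ℝ (Fin d), dist y x ≤ 3 / 4 * r ∧
      (∫⁻ z in ball x (r / 2), f z) + ∫⁻ z in ball y (r / 4), f z ≤ ∫⁻ z in ball x r, f z := by
  set e : EuclideanSpace ℝ (Fin d) := EuclideanSpace.single ⟨0, Nat.pos_of_ne_zero hd⟩ 1 with he
  have hdist : dist (x + (3 / 4 * r) • e) x = 3 / 4 * r := by
    rw [dist_eq_norm, add_sub_cancel_left, norm_smul, he, PiLp.norm_single, norm_one,
      mul_one, Real.norm_of_nonneg (by positivity)]
  refine ⟨x + (3 / 4 * r) • e, hdist.le, ?_⟩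
  rw [← lintegral_union measurableSet_ball]
  · apply lintegral_mono_set
    refine Set.union_subset (ball_subset_ball (by linarith)) (ball_subset_ball' ?_)
    rw [hdist]; linarith
  · apply ball_disjoint_ball
    rw [dist_comm, hdist]; linarith

theorem ReverseHolder.criticalRadius_pos_and_exists (hV : ReverseHolder s V) (hd : 3 ≤ d)
    (hs : (d : ℝ≥0∞) / 2 ≤ s) (hV0 : ¬ V =ᵐ[volume] 0) :
    (∀ x, 0 < criticalRadius V x) ∧
      ∃ C₀ N₀ : ℝ, 1 ≤ C₀ ∧ 0 < N₀ ∧ SlowlyVarying (criticalRadius V) C₀ N₀ := by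
  have hd0 : d ≠ 0 := by omega
  obtain ⟨C, hC, hRH⟩ := hV.exists_bound_half_dim hd0 hs
  set g : (EuclideanSpace ℝ (Fin d)) → ℝ≥0∞ := fun y => ENNReal.ofReal (V y) with hg
  have hgm : AEMeasurable g volume :=
    hV.locallyIntegrable.aestronglyMeasurable.aemeasurable.ennreal_ofReal
  have hdR : (3 : ℝ) ≤ d := by exact_mod_cast hd
  have hσ : (1 : ℝ) < d / 2 := by linarith
  set σ : ℝ := (d : ℝ) / 2 with hσdef
  have hσ0 : 0 < σ := by linarith
  -- Finiteness comes from the reverse Hölder bound itself, whose right side is finite because `V`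
  -- is locally integrable.
  have hgσ : ∀ x r, ∫⁻ y in ball x r, g y ^ σ ≠ ∞ := by
    intro x r
    rcases le_or_gt r 0 with hr | hr
    · simp [ball_eq_empty.2 hr]
    rw [setLIntegral_ball_eq_volume_mul_laverage]
    refine ENNReal.mul_ne_top measure_ball_lt_top.ne fun h => ?_
    have h1 := hRH x r hr
    rw [h, ENNReal.top_rpow_of_pos (by positivity), top_le_iff] at h1
    refine ENNReal.mul_ne_top ENNReal.ofReal_ne_top ?_ h1
    exact (laverage_lt_top (hV.setLIntegral_ne_top x r)).ne
  have hmonoS : ∀ {x y : EuclideanSpace ℝ (Fin d)} {r R : ℝ}, r + dist x y ≤ R → ball y r ⊆ ball x R := by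
    intro x y r R h
    apply ball_subset_ball'
    rwa [dist_comm]
  have hv := unitVolume_pos d
  have hN : ∀ x r, ∫ y in ball x r, V y = (∫⁻ y in ball x r, g y).toReal :=
    fun x r => hV.setIntegral_eq x r subset_rfl
  refine exists_slowly_varying_of_reverse_holder (m := d - 2) (e := 1 - 1 / σ) (τ := 1 / σ)
    (N := fun x r => ∫ y in ball x r, V y)
    (M := fun x r => (∫⁻ y in ball x r, g y ^ σ).toReal) (C := C)
    hd0 hv ?_ ?_ (by positivity) hC ?_ ?_ ?_ ?_ ?_ ?_ ?_ ?_ ?_ ?_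
  · rw [sub_pos, div_lt_one hσ0]; exact hσ
  · rw [Nat.cast_sub (by omega), hσdef]
    field_simp
    push_cast
    ring
  · intro x y r R _ h
    simp only [hN]
    exact ENNReal.toReal_mono (hV.setLIntegral_ne_top x R) (lintegral_mono_set (hmonoS h))
  · intro x y r R _ h
    exact ENNReal.toReal_mono (hgσ x R) (lintegral_mono_set (hmonoS h))
  · intro x r
    exact integral_nonneg hV.nonneg
  · intro x r
    exact ENNReal.toReal_nonneg
  · intro x
    simp
  · intro x
    by_contra! hcon
    apply hV0
    have h0 : ∀ n : ℕ, V =ᵐ[volume.restrict (ball x (n + 1))] 0 := by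
      intro n
      have h1 : ∫ y in ball x (n + 1), V y = 0 :=
        le_antisymm (hcon _ (by positivity)) (integral_nonneg hV.nonneg)
      exact (integral_eq_zero_iff_of_nonneg hV.nonneg (hV.integrableOn_ball x _)).1 h1
    have hU : (⋃ n : ℕ, ball x ((n : ℝ) + 1)) = Set.univ := by
      refine Set.eq_univ_of_forall fun y => Set.mem_iUnion.2 ?_
      obtain ⟨n, hn⟩ := exists_nat_gt (dist y x)
      exact ⟨n, by rw [mem_ball]; linarith⟩
    rw [← Measure.restrict_univ (μ := (volume : Measure (EuclideanSpace ℝ (Fin d)))), ← hU]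
    exact (ae_restrict_iUnion_iff _ _).2 h0
  · intro x r R hr hR
    have hsub : ball x r ⊆ ball x R := ball_subset_ball hR
    simp only [hN]
    have h1 : ∫⁻ y in ball x R \ ball x r, g y
        ≤ (∫⁻ y in ball x R, g y ^ σ) ^ (1 / σ) *
          ENNReal.ofReal (unitVolume d * (R ^ d - r ^ d)) ^ (1 - 1 / σ) := by
      refine (setLIntegral_le_rpow_mul_measure_rpow hgm.restrict hσ).trans ?_
      gcongr
      · exact Set.sdiff_subset
      · rw [sub_nonneg, div_le_one hσ0]; exact hσ.le
      · rw [measure_sdiff hsub measurableSet_ball.nullMeasurableSet measure_ball_lt_top.ne,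
          volume_ball_eq hd0 x hr, volume_ball_eq hd0 x (hr.trans hR),
          ← ENNReal.ofReal_sub _ (by positivity), mul_sub]
    have h2 : ∫⁻ y in ball x R, g y
        ≤ (∫⁻ y in ball x r, g y) + ∫⁻ y in ball x R \ ball x r, g y := by
      rw [← lintegral_inter_add_sdiff g (ball x R) measurableSet_ball (B := ball x r),
        Set.inter_eq_self_of_subset_right hsub]
    have hfin : (∫⁻ y in ball x R, g y ^ σ) ^ (1 / σ) *
          ENNReal.ofReal (unitVolume d * (R ^ d - r ^ d)) ^ (1 - 1 / σ) ≠ ∞ :=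
      ENNReal.mul_ne_top (ENNReal.rpow_ne_top_of_nonneg (by positivity) (hgσ x R))
        (ENNReal.rpow_ne_top_of_nonneg
          (by rw [sub_nonneg, div_le_one hσ0]; exact hσ.le) ENNReal.ofReal_ne_top)
    have h3 := ENNReal.toReal_mono
      (ENNReal.add_ne_top.2 ⟨hV.setLIntegral_ne_top x r, hfin⟩) (h2.trans (add_le_add_right h1 _))
    rw [ENNReal.toReal_add (hV.setLIntegral_ne_top x r) hfin, ENNReal.toReal_mul,
      ← ENNReal.toReal_rpow, ← ENNReal.toReal_rpow, ENNReal.toReal_ofReal] at h3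
    · linarith
    · exact mul_nonneg hv.le (sub_nonneg.2 (pow_le_pow_left₀ hr hR d))
  · intro x r hr
    simp only [hN]
    have hB0 : volume (ball x r) ≠ 0 := (measure_ball_pos _ _ hr).ne'
    have hBt : volume (ball x r) ≠ ∞ := measure_ball_lt_top.ne
    have h1 : (∫⁻ y in ball x r, g y ^ σ) ^ (1 / σ)
        ≤ ENNReal.ofReal C * volume (ball x r) ^ (-(1 - 1 / σ)) * ∫⁻ y in ball x r, g y := by
      calc (∫⁻ y in ball x r, g y ^ σ) ^ (1 / σ)
          = volume (ball x r) ^ (1 / σ) * (⨍⁻ y in ball x r, g y ^ σ ∂volume) ^ (1 / σ) := by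
            rw [setLIntegral_ball_eq_volume_mul_laverage,
              ENNReal.mul_rpow_of_nonneg _ _ (by positivity)]
        _ ≤ volume (ball x r) ^ (1 / σ) * (ENNReal.ofReal C * ⨍⁻ y in ball x r, g y ∂volume) := by
            gcongr; exact hRH x r hr
        _ = _ := by
            rw [laverage_ball_eq, ← ENNReal.rpow_neg_one,
              show -(1 - 1 / σ) = 1 / σ + -1 by ring, ENNReal.rpow_add _ _ hB0 hBt]
            ring
    have h2 := ENNReal.toReal_mono (ENNReal.mul_ne_top (ENNReal.mul_ne_top ENNReal.ofReal_ne_top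
      (ENNReal.rpow_ne_top_of_ne_zero hB0 hBt)) (hV.setLIntegral_ne_top x r)) h1
    rwa [ENNReal.toReal_mul, ENNReal.toReal_mul, ← ENNReal.toReal_rpow, ← ENNReal.toReal_rpow,
      ENNReal.toReal_ofReal hC.le, volume_ball_eq hd0 x hr.le,
      ENNReal.toReal_ofReal (by positivity)] at h2
  · intro x r hr
    obtain ⟨y, hy, h⟩ := exists_volume_add_le hd0 (fun z => g z ^ σ) x hr
    refine ⟨y, hy, ?_⟩
    rw [← ENNReal.toReal_add (hgσ _ _) (hgσ _ _)]
    exact ENNReal.toReal_mono (hgσ _ _) h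
  · intro x
    rfl

end ReverseHolder

/-! ### Algebra of the factors `(1 + r/ρ)^θ` and the suprema defining the norms. -/

section Growth

variable {d : ℕ} {ρ : EuclideanSpace ℝ (Fin d) → ℝ} {x : EuclideanSpace ℝ (Fin d)} {r : ℝ}

theorem one_add_div_pos (hρ : 0 < ρ x) (hr : 0 < r) : 0 < 1 + r / ρ x := by positivity

theorem growth_ne_top (θ : ℝ) : growth ρ θ x r ≠ ∞ := ENNReal.ofReal_ne_top

theorem growth_mul (hρ : 0 < ρ x) (hr : 0 < r) (a b : ℝ) :
    growth ρ a x r * growth ρ b x r = growth ρ (a + b) x r := by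
  have := one_add_div_pos hρ hr
  rw [growth, growth, growth, ← ENNReal.ofReal_mul (by positivity), Real.rpow_add this]

theorem growth_mul_neg (hρ : 0 < ρ x) (hr : 0 < r) (a : ℝ) :
    growth ρ a x r * growth ρ (-a) x r = 1 := by
  rw [growth_mul hρ hr, add_neg_cancel, growth, Real.rpow_zero, ENNReal.ofReal_one]

theorem growth_neg_mul_le_iff (hρ : 0 < ρ x) (hr : 0 < r) {a : ℝ} {b c : ℝ≥0∞} :
    growth ρ (-a) x r * b ≤ c ↔ b ≤ c * growth ρ a x r := by
  constructor
  · intro h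
    calc b = growth ρ a x r * growth ρ (-a) x r * b := by rw [growth_mul_neg hρ hr, one_mul]
      _ = growth ρ (-a) x r * b * growth ρ a x r := by ring
      _ ≤ _ := by gcongr
  · intro h
    calc growth ρ (-a) x r * b ≤ growth ρ (-a) x r * (c * growth ρ a x r) := by gcongr
      _ = growth ρ a x r * growth ρ (-a) x r * c := by ring
      _ = c := by rw [growth_mul_neg hρ hr, one_mul]

theorem iSup_growth_ne_top (hρ : ∀ x, 0 < ρ x) {θ : ℝ}
    {F : EuclideanSpace ℝ (Fin d) → ℝ → ℝ≥0∞}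
    (h : ∃ C : ℝ, 0 < C ∧ ∀ x r, 0 < r → F x r ≤ ENNReal.ofReal C * growth ρ θ x r) :
    ⨆ (x : EuclideanSpace ℝ (Fin d)) (r : ℝ) (_ : 0 < r), growth ρ (-θ) x r * F x r ≠ ∞ := by
  obtain ⟨C, -, h⟩ := h
  refine ne_top_of_le_ne_top (ENNReal.ofReal_ne_top (r := C)) ?_
  exact iSup_le fun x => iSup_le fun r => iSup_le fun hr =>
    (growth_neg_mul_le_iff (hρ x) hr).2 (h x r hr)

theorem le_iSup_growth (hρ : ∀ x, 0 < ρ x) {θ : ℝ}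
    (F : EuclideanSpace ℝ (Fin d) → ℝ → ℝ≥0∞) (x : EuclideanSpace ℝ (Fin d)) {r : ℝ} (hr : 0 < r) :
    F x r ≤ (⨆ (x : EuclideanSpace ℝ (Fin d)) (r : ℝ) (_ : 0 < r), growth ρ (-θ) x r * F x r) *
      growth ρ θ x r := by
  refine (growth_neg_mul_le_iff (hρ x) hr).1 ?_
  exact le_iSup_of_le x (le_iSup_of_le r (le_iSup_of_le hr le_rfl))

end Growth

/-! ### Positivity of `A_{p,q}` weights and the two weighted inequalities. -/

section Weights

variable {d : ℕ} {ω : EuclideanSpace ℝ (Fin d) → ℝ} {x₀ : EuclideanSpace ℝ (Fin d)} {r p q : ℝ}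

theorem IsWeight.aemeasurable_ofReal (hω : IsWeight ω) :
    AEMeasurable (fun x => ENNReal.ofReal (ω x)) volume :=
  hω.locallyIntegrable.aestronglyMeasurable.aemeasurable.ennreal_ofReal

theorem IsWeight.ae_eq_zero_of_meanPow (hω : IsWeight ω) (hq : 0 < q)
    (h : meanPow q ω (ball x₀ r) = 0) : ∀ᵐ x ∂volume.restrict (ball x₀ r), ω x = 0 := by
  rw [meanPow, ENNReal.rpow_eq_zero_iff_of_pos (by positivity), laverage_ball_eq,
    mul_eq_zero, ENNReal.inv_eq_zero, or_iff_right measure_ball_lt_top.ne,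
    lintegral_eq_zero_iff' (hω.aemeasurable_ofReal.restrict.pow_const q)] at h
  filter_upwards [h] with x hx
  rw [Pi.zero_apply, ENNReal.rpow_eq_zero_iff_of_pos hq, ENNReal.ofReal_eq_zero] at hx
  exact le_antisymm hx (hω.nonneg x)

theorem IsWeight.ae_pos_of_dualMean (hω : IsWeight ω) (hp : 1 ≤ p)
    (h : dualMean p ω (ball x₀ r) ≠ ∞) : ∀ᵐ x ∂volume.restrict (ball x₀ r), 0 < ω x := by
  rw [dualMean] at h
  split_ifs at h with hp1
  · rw [Ne, ENNReal.inv_eq_top] at h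
    filter_upwards [ae_essInf_le (f := fun x => ENNReal.ofReal (ω x))] with x hx
    exact ENNReal.ofReal_pos.1 ((pos_iff_ne_zero.2 h).trans_le hx)
  · have hp' : 0 < p / (p - 1) := by
      have : 1 < p := lt_of_le_of_ne hp (Ne.symm hp1)
      exact div_pos (by linarith) (by linarith)
    have h1 : ∫⁻ x in ball x₀ r, ENNReal.ofReal (ω x) ^ (-(p / (p - 1))) ≠ ∞ := by
      rw [setLIntegral_ball_eq_volume_mul_laverage]
      refine ENNReal.mul_ne_top measure_ball_lt_top.ne fun h2 => h ?_
      rw [h2, ENNReal.top_rpow_of_pos (by positivity)]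
    filter_upwards [ae_lt_top' (hω.aemeasurable_ofReal.restrict.pow_const _) h1] with x hx
    by_contra h0
    rw [ENNReal.ofReal_eq_zero.2 (not_lt.1 h0), ENNReal.zero_rpow_of_neg (by linarith)] at hx
    exact lt_irrefl _ hx

/-- Hölder's inequality with the weight and its dual average. -/
theorem laverage_le_mul_dualMean (hω : IsWeight ω) (hr : 0 < r) (hp : 1 ≤ p) (hpq : p ≤ q)
    (hpos : ∀ᵐ x ∂volume.restrict (ball x₀ r), 0 < ω x) {u : EuclideanSpace ℝ (Fin d) → ℝ≥0∞}
    (hu : AEMeasurable u (volume.restrict (ball x₀ r))) :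
    ⨍⁻ x in ball x₀ r, u x ∂volume ≤
      (⨍⁻ x in ball x₀ r, (u x * ENNReal.ofReal (ω x)) ^ q ∂volume) ^ (1 / q) *
        dualMean p ω (ball x₀ r) := by
  have := neZero_restrict_ball x₀ hr
  set w : EuclideanSpace ℝ (Fin d) → ℝ≥0∞ := fun x => ENNReal.ofReal (ω x) with hw
  have hwm : AEMeasurable w (volume.restrict (ball x₀ r)) := hω.aemeasurable_ofReal.restrict
  have huw : AEMeasurable (fun x => u x * w x) (volume.restrict (ball x₀ r)) := hu.mul hwm
  -- Jensen replaces the exponent `q` by `p`, leaving Hölder with the conjugate pair `p`, `p'`.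
  refine le_trans ?_ (mul_le_mul_left
    (laverage_rpow_le_laverage_rpow huw (by linarith) hpq) (dualMean p ω (ball x₀ r)))
  have hsplit : ∀ᵐ x ∂volume.restrict (ball x₀ r), u x = u x * w x * (w x)⁻¹ := by
    filter_upwards [hpos] with x hx
    rw [mul_assoc, ENNReal.mul_inv_cancel (ENNReal.ofReal_pos.2 hx).ne' ENNReal.ofReal_ne_top,
      mul_one]
  rw [dualMean]
  split_ifs with hp1
  · simp only [hp1, ENNReal.rpow_one, div_one]
    rw [laverage_eq' _ (fun x => u x * w x), ← lintegral_mul_const'' _ (huw.smul_measure _),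
      ← laverage_eq']
    apply laverage_mono_ae
    filter_upwards [hsplit, ae_essInf_le (f := w)] with x hx hle
    refine hx.le.trans ?_
    gcongr
  · have hp' : 1 < p := lt_of_le_of_ne hp (Ne.symm hp1)
    have hpq' : p.HolderConjugate (p / (p - 1)) := Real.HolderConjugate.conjExponent hp'
    rw [laverage_congr hsplit]
    have := ENNReal.lintegral_mul_le_Lp_mul_Lq
      ((volume.restrict (ball x₀ r) Set.univ)⁻¹ • volume.restrict (ball x₀ r)) hpq'
      (huw.smul_measure _) (hwm.inv.smul_measure _)
    simp only [Pi.mul_apply, Pi.inv_apply, ENNReal.inv_rpow, ← ENNReal.rpow_neg] at this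
    exact this

theorem one_le_meanPow_mul_dualMean (hω : IsWeight ω) (hr : 0 < r) (hp : 1 ≤ p)
    (hpos : ∀ᵐ x ∂volume.restrict (ball x₀ r), 0 < ω x) :
    1 ≤ meanPow p ω (ball x₀ r) * dualMean p ω (ball x₀ r) := by
  have := neZero_restrict_ball x₀ hr
  have h := laverage_le_mul_dualMean hω hr hp le_rfl hpos (aemeasurable_const (b := (1 : ℝ≥0∞)))
  rw [laverage_one] at h
  simpa only [one_mul, meanPow] using h

theorem meanPow_mono (hω : IsWeight ω) (hr : 0 < r) (hp : 0 < p) (hpq : p ≤ q) :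
    meanPow p ω (ball x₀ r) ≤ meanPow q ω (ball x₀ r) := by
  have := neZero_restrict_ball x₀ hr
  exact laverage_rpow_le_laverage_rpow hω.aemeasurable_ofReal.restrict hp hpq

variable {ρ : EuclideanSpace ℝ (Fin d) → ℝ} {θ : ℝ}

/-- Since `0 * ∞ = 0`, the class condition on one ball also allows `ω = 0` there almost everywhere;
otherwise the dual mean is finite and `ω > 0`. Balls centred at the origin all contain the unit
ball, so the same alternative holds on all of them, and vanishing everywhere is excluded. -/
theorem MemApq.ae_pos (hω : MemApq ρ p q θ ω) (hp : 1 ≤ p) (hpq : p < q) :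
    ∀ᵐ x, 0 < ω x := by
  obtain ⟨hw, C, hC, h⟩ := hω
  have hq : 0 < q := by linarith
  have halt : ∀ n : ℕ, (∀ᵐ x ∂volume.restrict (ball (0 : EuclideanSpace ℝ (Fin d)) (n + 1)), 0 < ω x) ∨
      ∀ᵐ x ∂volume.restrict (ball (0 : EuclideanSpace ℝ (Fin d)) (n + 1)), ω x = 0 := by
    intro n
    by_cases h0 : meanPow q ω (ball 0 (n + 1)) = 0
    · exact Or.inr (hw.ae_eq_zero_of_meanPow hq h0)
    · refine Or.inl (hw.ae_pos_of_dualMean hp fun htop => ?_)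
      have h1 := h 0 (n + 1) (by positivity)
      rw [htop, ENNReal.mul_top h0, top_le_iff] at h1
      exact ENNReal.mul_ne_top ENNReal.ofReal_ne_top (growth_ne_top θ) h1
  have hU : (⋃ n : ℕ, ball (0 : EuclideanSpace ℝ (Fin d)) ((n : ℝ) + 1)) = Set.univ := by
    refine Set.eq_univ_of_forall fun y => Set.mem_iUnion.2 ?_
    obtain ⟨n, hn⟩ := exists_nat_gt (dist y 0)
    exact ⟨n, by rw [mem_ball]; linarith⟩
  have hglob : ∀ P : EuclideanSpace ℝ (Fin d) → Prop,
      (∀ n : ℕ, ∀ᵐ x ∂volume.restrict (ball (0 : EuclideanSpace ℝ (Fin d)) (n + 1)), P x) →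
      ∀ᵐ x, P x := by
    intro P hP
    rw [← Measure.restrict_univ (μ := (volume : Measure (EuclideanSpace ℝ (Fin d)))), ← hU]
    exact (ae_restrict_iUnion_iff _ _).2 hP
  refine hglob _ fun n => (halt n).resolve_right fun hn => hw.not_ae_zero ?_
  have hball : ∀ k : ℕ, ball (0 : EuclideanSpace ℝ (Fin d)) 1 ⊆ ball 0 ((k : ℝ) + 1) :=
    fun k => ball_subset_ball (by linarith [(Nat.cast_nonneg k : (0 : ℝ) ≤ k)])
  have := neZero_restrict_ball (0 : EuclideanSpace ℝ (Fin d)) one_pos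
  refine hglob _ fun k => (halt k).resolve_left fun hk => ?_
  obtain ⟨x, hx1, hx2⟩ := ((ae_restrict_of_ae_restrict_of_subset (hball n) hn).and
    (ae_restrict_of_ae_restrict_of_subset (hball k) hk)).exists
  exact hx2.ne' hx1

theorem MemApq.meanPow_ne_zero (hω : MemApq ρ p q θ ω) (hp : 1 ≤ p) (hpq : p < q) (hr : 0 < r)
    {t : ℝ} (ht : 0 < t) : meanPow t ω (ball x₀ r) ≠ 0 := by
  intro h
  have := neZero_restrict_ball x₀ hr
  obtain ⟨x, hx1, hx2⟩ := ((hω.1.ae_eq_zero_of_meanPow ht h).and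
    (ae_restrict_of_ae (hω.ae_pos hp hpq))).exists
  exact hx2.ne' hx1

theorem MemApq.dualMean_ne_zero (hω : MemApq ρ p q θ ω) (hp : 1 ≤ p) (hpq : p < q)
    (hr : 0 < r) : dualMean p ω (ball x₀ r) ≠ 0 := by
  intro h
  have h1 := one_le_meanPow_mul_dualMean (x₀ := x₀) hω.1 hr hp (ae_restrict_of_ae (hω.ae_pos hp hpq))
  simp [h] at h1

theorem MemApq.meanPow_ne_top (hω : MemApq ρ p q θ ω) (hp : 1 ≤ p) (hpq : p < q)
    (hr : 0 < r) : meanPow q ω (ball x₀ r) ≠ ∞ := by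
  intro h
  obtain ⟨C, -, hC⟩ := hω.2
  have h1 := hC x₀ r hr
  rw [h, ENNReal.top_mul (hω.dualMean_ne_zero hp hpq hr), top_le_iff] at h1
  exact ENNReal.mul_ne_top ENNReal.ofReal_ne_top (growth_ne_top θ) h1

/-- In terms of averages the powers `1/p` and `1/q` of `|B|` cancel, leaving the normalisation
`|B|^(-β/d)` shared with `campanatoMean_eq`. -/
theorem weightedMean_eq (hp : 0 < p) (hq : 0 < q) (β : ℝ) (f : EuclideanSpace ℝ (Fin d) → ℝ)
    (hr : 0 < r) :
    weightedMean p q β ω f x₀ r =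
      volume (ball x₀ r) ^ (-(β / d)) * (meanPow p ω (ball x₀ r))⁻¹ *
        (⨍⁻ x in ball x₀ r, (lowerOsc f (ball x₀ r) x * ENNReal.ofReal (ω x)) ^ q ∂volume)
          ^ (1 / q) := by
  have hB0 : volume (ball x₀ r) ≠ 0 := (measure_ball_pos _ _ hr).ne'
  have hBt : volume (ball x₀ r) ≠ ∞ := measure_ball_lt_top.ne
  have hBp0 : volume (ball x₀ r) ^ (1 / p) ≠ 0 := (ENNReal.rpow_pos (pos_iff_ne_zero.2 hB0) hBt).ne'
  have hBpt : volume (ball x₀ r) ^ (1 / p) ≠ ∞ := ENNReal.rpow_ne_top_of_ne_zero hB0 hBt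
  rw [weightedMean, meanPow]
  simp_rw [← ENNReal.mul_rpow_of_nonneg _ _ hq.le]
  rw [setLIntegral_ball_eq_volume_mul_laverage (fun x => ENNReal.ofReal (ω x) ^ p),
    setLIntegral_ball_eq_volume_mul_laverage, ENNReal.mul_rpow_of_nonneg _ _ (by positivity),
    ENNReal.mul_rpow_of_nonneg _ _ (by positivity), ENNReal.div_eq_inv_mul,
    ENNReal.mul_inv (Or.inl hBp0) (Or.inl hBpt), ← ENNReal.rpow_neg]
  have : volume (ball x₀ r) ^ (-(1 / p)) * volume (ball x₀ r) ^ (1 / p - 1 / q - β / d) *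
      volume (ball x₀ r) ^ (1 / q) = volume (ball x₀ r) ^ (-(β / d)) := by
    rw [← ENNReal.rpow_add _ _ hB0 hBt, ← ENNReal.rpow_add _ _ hB0 hBt]
    congr 1; ring
  rw [← this]
  ring

theorem campanatoMean_eq (β : ℝ) (f : EuclideanSpace ℝ (Fin d) → ℝ) (hr : 0 < r) :
    campanatoMean β f x₀ r =
      volume (ball x₀ r) ^ (-(β / d)) * ⨍⁻ x in ball x₀ r, lowerOsc f (ball x₀ r) x ∂volume := by
  have hB0 : volume (ball x₀ r) ≠ 0 := (measure_ball_pos _ _ hr).ne'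
  have hBt : volume (ball x₀ r) ≠ ∞ := measure_ball_lt_top.ne
  rw [campanatoMean, laverage_ball_eq, ← mul_assoc, ← ENNReal.rpow_neg_one,
    ← ENNReal.rpow_add _ _ hB0 hBt]
  congr 2; ring

theorem lowerOsc_aemeasurable {f : EuclideanSpace ℝ (Fin d) → ℝ}
    {μ : Measure (EuclideanSpace ℝ (Fin d))} (hf : AEMeasurable f μ)
    (B : Set (EuclideanSpace ℝ (Fin d))) : AEMeasurable (lowerOsc f B) μ := by
  unfold lowerOsc
  induction essInf (fun y => (f y : EReal)) (volume.restrict B) using EReal.rec with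
  | bot => simp
  | top => simp
  | coe a =>
    have : ∀ x, ((f x : EReal) - (a : EReal)).toENNReal = ENNReal.ofReal (f x - a) := by
      intro x
      rw [← EReal.coe_sub, EReal.toENNReal_of_ne_top (EReal.coe_ne_top _), EReal.toReal_coe]
    simp_rw [this]
    exact (hf.sub_const a).ennreal_ofReal

theorem MemApq.campanatoMean_le (hω : MemApq ρ p q θ ω) (hp : 1 ≤ p) (hpq : p < q) (β : ℝ)
    {f : EuclideanSpace ℝ (Fin d) → ℝ} (hf : AEMeasurable f volume) (hr : 0 < r) :
    campanatoMean β f x₀ r ≤ meanPow q ω (ball x₀ r) * dualMean p ω (ball x₀ r) *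
      weightedMean p q β ω f x₀ r := by
  have hp0 : 0 < p := by linarith
  have hmp : meanPow p ω (ball x₀ r) ≤ meanPow q ω (ball x₀ r) := meanPow_mono hω.1 hr hp0 hpq.le
  have hmt : meanPow p ω (ball x₀ r) ≠ ∞ := ne_top_of_le_ne_top (hω.meanPow_ne_top hp hpq hr) hmp
  have hm0 : meanPow p ω (ball x₀ r) ≠ 0 := hω.meanPow_ne_zero hp hpq hr hp0
  have h := laverage_le_mul_dualMean (x₀ := x₀) hω.1 hr hp hpq.le
    (ae_restrict_of_ae (hω.ae_pos hp hpq)) (lowerOsc_aemeasurable hf (ball x₀ r)).restrict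
  rw [campanatoMean_eq β f hr]
  refine (mul_le_mul_right h _).trans ?_
  -- The weighted mean is normalised by the `p`-mean of `ω`, the class constant by its `q`-mean;
  -- Jensen passes from one to the other.
  refine le_trans (le_of_eq ?_) (mul_le_mul_left (mul_le_mul_left hmp _) _)
  rw [weightedMean_eq hp0 (hp0.trans hpq) β f hr]
  set J := (⨍⁻ x in ball x₀ r, (lowerOsc f (ball x₀ r) x * ENNReal.ofReal (ω x)) ^ q ∂volume)
          ^ (1 / q)
  calc volume (ball x₀ r) ^ (-(β / d)) * (J * dualMean p ω (ball x₀ r))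
      = (meanPow p ω (ball x₀ r) * (meanPow p ω (ball x₀ r))⁻¹) *
        (volume (ball x₀ r) ^ (-(β / d)) * (J * dualMean p ω (ball x₀ r))) := by
        rw [ENNReal.mul_inv_cancel hm0 hmt, one_mul]
    _ = _ := by ring

theorem MemApq.weightedMean_le (hω : MemApq ρ p q θ ω) (hp : 1 ≤ p) (hpq : p < q) (β : ℝ)
    {f : EuclideanSpace ℝ (Fin d) → ℝ} (hr : 0 < r) {K : ℝ≥0∞}
    (hK : ∀ᵐ x ∂volume.restrict (ball x₀ r),
      lowerOsc f (ball x₀ r) x ≤ volume (ball x₀ r) ^ (β / d) * K) :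
    weightedMean p q β ω f x₀ r ≤ K * (meanPow q ω (ball x₀ r) * dualMean p ω (ball x₀ r)) := by
  have hp0 : 0 < p := by linarith
  have hq0 : 0 < q := by linarith
  have hB0 : volume (ball x₀ r) ≠ 0 := (measure_ball_pos _ _ hr).ne'
  have hBt : volume (ball x₀ r) ≠ ∞ := measure_ball_lt_top.ne
  have hmp : meanPow p ω (ball x₀ r) ≤ meanPow q ω (ball x₀ r) := meanPow_mono hω.1 hr hp0 hpq.le
  have hmt : meanPow p ω (ball x₀ r) ≠ ∞ := ne_top_of_le_ne_top (hω.meanPow_ne_top hp hpq hr) hmp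
  have hm0 : meanPow p ω (ball x₀ r) ≠ 0 := hω.meanPow_ne_zero hp hpq hr hp0
  have hdual : (meanPow p ω (ball x₀ r))⁻¹ ≤ dualMean p ω (ball x₀ r) := by
    rw [ENNReal.inv_le_iff_le_mul (fun _ => hm0) (fun h => absurd h hmt)]
    exact one_le_meanPow_mul_dualMean hω.1 hr hp (ae_restrict_of_ae (hω.ae_pos hp hpq))
  have hJ : (⨍⁻ x in ball x₀ r, (lowerOsc f (ball x₀ r) x * ENNReal.ofReal (ω x)) ^ q ∂volume)
      ^ (1 / q) ≤ volume (ball x₀ r) ^ (β / d) * K * meanPow q ω (ball x₀ r) := by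
    set L := volume (ball x₀ r) ^ (β / d) * K
    have h1 : ⨍⁻ x in ball x₀ r, (lowerOsc f (ball x₀ r) x * ENNReal.ofReal (ω x)) ^ q ∂volume ≤
        L ^ q * ⨍⁻ x in ball x₀ r, ENNReal.ofReal (ω x) ^ q ∂volume := by
      rw [laverage_eq' _ (fun x => ENNReal.ofReal (ω x) ^ q), ← lintegral_const_mul'' _
        ((hω.1.aemeasurable_ofReal.restrict.pow_const q).smul_measure _), ← laverage_eq']
      apply laverage_mono_ae
      filter_upwards [hK] with x hx
      rw [← ENNReal.mul_rpow_of_nonneg _ _ hq0.le]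
      gcongr
    refine (ENNReal.rpow_le_rpow h1 (by positivity)).trans (le_of_eq ?_)
    rw [ENNReal.mul_rpow_of_nonneg _ _ (by positivity), ← ENNReal.rpow_mul, mul_one_div,
      div_self hq0.ne', ENNReal.rpow_one, meanPow]
  rw [weightedMean_eq hp0 hq0 β f hr]
  calc _ ≤ volume (ball x₀ r) ^ (-(β / d)) * dualMean p ω (ball x₀ r) *
        (volume (ball x₀ r) ^ (β / d) * K * meanPow q ω (ball x₀ r)) := by gcongr
    _ = volume (ball x₀ r) ^ (-(β / d)) * volume (ball x₀ r) ^ (β / d) *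
        (K * (meanPow q ω (ball x₀ r) * dualMean p ω (ball x₀ r))) := by ring
    _ = _ := by
        rw [← ENNReal.rpow_add _ _ hB0 hBt, neg_add_cancel, ENNReal.rpow_zero, one_mul]

end Weights

/-! ### Pointwise oscillation bound through dyadic averages. -/

section Pointwise

variable {d : ℕ} {f : EuclideanSpace ℝ (Fin d) → ℝ} {x₀ : EuclideanSpace ℝ (Fin d)} {r : ℝ}

/-- An essential infimum `-∞` would make the oscillation infinite on a set of positive measure, and
`+∞` is impossible for real-valued `f`. From here on the oscillation is an ordinary real difference.
-/
theorem exists_essInf_eq_coe (hf : AEMeasurable f volume) (hr : 0 < r)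
    (h : ∫⁻ x in ball x₀ r, lowerOsc f (ball x₀ r) x ≠ ∞) :
    ∃ m : ℝ, essInf (fun y => (f y : EReal)) (volume.restrict (ball x₀ r)) = m ∧
      (∀ᵐ x ∂volume.restrict (ball x₀ r), m ≤ f x) ∧
      (∀ x, lowerOsc f (ball x₀ r) x = ENNReal.ofReal (f x - m)) ∧
      IntegrableOn f (ball x₀ r) := by
  have := neZero_restrict_ball x₀ hr
  have hle : ∀ᵐ x ∂volume.restrict (ball x₀ r),
      essInf (fun y => (f y : EReal)) (volume.restrict (ball x₀ r)) ≤ f x :=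
    ae_essInf_le (f := fun y => (f y : EReal))
  unfold lowerOsc at h ⊢
  induction hm : essInf (fun y => (f y : EReal)) (volume.restrict (ball x₀ r)) using EReal.rec with
  | bot =>
    simp only [hm] at h
    simp [(measure_ball_pos volume x₀ hr).ne', ENNReal.top_mul] at h
  | top =>
    rw [hm] at hle
    obtain ⟨x, hx⟩ := hle.exists
    simp at hx
  | coe m =>
    rw [hm] at hle h
    have hosc : ∀ x, ((f x : EReal) - (m : EReal)).toENNReal = ENNReal.ofReal (f x - m) := by
      intro x
      rw [← EReal.coe_sub, EReal.toENNReal_of_ne_top (EReal.coe_ne_top _), EReal.toReal_coe]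
    have hle' : ∀ᵐ x ∂volume.restrict (ball x₀ r), m ≤ f x := by
      filter_upwards [hle] with x hx
      exact_mod_cast hx
    refine ⟨m, rfl, hle', hosc, ?_⟩
    simp_rw [hosc] at h
    have hsub : Integrable (fun x => f x - m) (volume.restrict (ball x₀ r)) := by
      refine (lintegral_ofReal_ne_top_iff_integrable
        (hf.restrict.sub_const m).aestronglyMeasurable ?_).1 h
      filter_upwards [hle'] with x hx
      exact sub_nonneg.2 hx
    have hadd := hsub.add (integrable_const m)
    simpa [IntegrableOn, Pi.add_def] using hadd

/-- The mean oscillation over `B` controls the mean of `f` over smaller balls. -/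
theorem average_sub_le {m R : ℝ} {y x : EuclideanSpace ℝ (Fin d)} (hd : d ≠ 0) (hr : 0 < r)
    (hsub : ball y r ⊆ ball x (2 * r)) (hm : ∀ᵐ z ∂volume.restrict (ball x (2 * r)), m ≤ f z)
    (hint : IntegrableOn f (ball x (2 * r)))
    (hR : ∫⁻ z in ball x (2 * r), ENNReal.ofReal (f z - m) ≤
      ENNReal.ofReal (R * (unitVolume d * (2 * r) ^ d))) (hR0 : 0 ≤ R) :
    ⨍ z in ball y r, f z ∂volume ≤ m + 2 ^ d * R := by
  have := neZero_restrict_ball y hr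
  have hv := unitVolume_pos d
  have hvol : volume.real (ball y r) = unitVolume d * r ^ d := by
    rw [measureReal_def, volume_ball_eq hd y hr.le, ENNReal.toReal_ofReal (by positivity)]
  have hint' : Integrable (fun z => f z - m) (volume.restrict (ball x (2 * r))) :=
    hint.sub (integrable_const m)
  have hnn : 0 ≤ᵐ[volume.restrict (ball x (2 * r))] fun z => f z - m := by
    filter_upwards [hm] with z hz
    exact sub_nonneg.2 hz
  have h1 : ∫ z in ball y r, (f z - m) ≤ R * (unitVolume d * (2 * r) ^ d) := by
    calc ∫ z in ball y r, (f z - m) ≤ ∫ z in ball x (2 * r), (f z - m) :=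
          setIntegral_mono_set hint' hnn hsub.eventuallyLE
      _ = (∫⁻ z in ball x (2 * r), ENNReal.ofReal (f z - m)).toReal :=
          integral_eq_lintegral_of_nonneg_ae hnn hint'.aestronglyMeasurable
      _ ≤ _ := ENNReal.toReal_le_of_le_ofReal (by positivity) hR
  have h2 : ∫ z in ball y r, (f z - m) =
      (∫ z in ball y r, f z) - unitVolume d * r ^ d * m := by
    rw [integral_sub (hint.mono_set hsub) (integrable_const m), setIntegral_const, hvol, smul_eq_mul]
  rw [setAverage_eq, hvol, smul_eq_mul, inv_mul_le_iff₀ (by positivity)]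
  rw [h2] at h1
  calc ∫ z in ball y r, f z ≤ R * (unitVolume d * (2 * r) ^ d) + unitVolume d * r ^ d * m := by
        linarith
    _ = _ := by rw [mul_pow]; ring

theorem le_average {m : ℝ} (hr : 0 < r) (hm : ∀ᵐ z ∂volume.restrict (ball x₀ r), m ≤ f z)
    (hint : IntegrableOn f (ball x₀ r)) : m ≤ ⨍ z in ball x₀ r, f z ∂volume := by
  have := neZero_restrict_ball x₀ hr
  calc m = ⨍ z in ball x₀ r, m ∂volume := (average_const _ m).symm
    _ ≤ _ := by
      rw [average_eq, average_eq]
      exact smul_le_smul_of_nonneg_left (integral_mono_ae (integrable_const m) hint hm)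
        (by positivity)

theorem ae_tendsto_average_ball (hd : d ≠ 0) (hf : LocallyIntegrable f volume) :
    ∀ᵐ x, ∀ δ : ℕ → ℝ, Filter.Tendsto δ Filter.atTop (nhdsWithin 0 (Set.Ioi 0)) →
      Filter.Tendsto (fun n => ⨍ z in ball x (δ n), f z ∂volume) Filter.atTop (nhds (f x)) := by
  have : Nonempty (Fin d) := ⟨⟨0, Nat.pos_of_ne_zero hd⟩⟩
  filter_upwards [IsUnifLocDoublingMeasure.ae_tendsto_average volume hf 1] with x hx δ hδ
  have hpos : ∀ᶠ n in Filter.atTop, 0 < δ n := hδ.eventually self_mem_nhdsWithin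
  refine (hx (fun _ => x) δ hδ ?_).congr' ?_
  · filter_upwards [hpos] with n hn
    exact mem_closedBall_self (by linarith)
  · filter_upwards [hpos] with n hn
    refine setAverage_congr (Filter.EventuallyEq.symm ?_)
    refine ae_eq_of_subset_of_measure_ge ball_subset_closedBall ?_
      measurableSet_ball.nullMeasurableSet measure_closedBall_lt_top.ne
    rw [Measure.addHaar_closedBall_eq_addHaar_ball]

variable {ρ : EuclideanSpace ℝ (Fin d) → ℝ} {β θ Q : ℝ}

theorem lintegral_lowerOsc_le (hd : d ≠ 0) (hρ : ∀ x, 0 < ρ x) (hQ0 : 0 ≤ Q)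
    (hQ : ∀ x r, 0 < r → campanatoMean β f x r ≤ ENNReal.ofReal Q * growth ρ θ x r)
    (x : EuclideanSpace ℝ (Fin d)) (hr : 0 < r) :
    ∫⁻ z in ball x r, lowerOsc f (ball x r) z ≤
      ENNReal.ofReal (Q * (1 + r / ρ x) ^ θ * (unitVolume d * r ^ d) ^ (β / d) *
        (unitVolume d * r ^ d)) := by
  have hv := unitVolume_pos d
  have hρx := hρ x
  have hB0 : volume (ball x r) ≠ 0 := (measure_ball_pos _ _ hr).ne'
  have hBt : volume (ball x r) ≠ ∞ := measure_ball_lt_top.ne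
  have h := hQ x r hr
  rw [campanatoMean, growth] at h
  have e1 : volume (ball x r) ^ (β / d) * volume (ball x r) *
      volume (ball x r) ^ (-(1 + β / d)) = 1 := by
    nth_rw 2 [← ENNReal.rpow_one (volume (ball x r))]
    rw [← ENNReal.rpow_add _ _ hB0 hBt, ← ENNReal.rpow_add _ _ hB0 hBt]
    convert ENNReal.rpow_zero using 2
    ring
  have e2 : volume (ball x r) = ENNReal.ofReal (unitVolume d * r ^ d) := volume_ball_eq hd x hr.le
  calc ∫⁻ z in ball x r, lowerOsc f (ball x r) z
      = volume (ball x r) ^ (β / d) * volume (ball x r) *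
        (volume (ball x r) ^ (-(1 + β / d)) * ∫⁻ z in ball x r, lowerOsc f (ball x r) z) := by
        rw [← mul_assoc, e1, one_mul]
    _ ≤ volume (ball x r) ^ (β / d) * volume (ball x r) *
        (ENNReal.ofReal Q * ENNReal.ofReal ((1 + r / ρ x) ^ θ)) := by gcongr
    _ = _ := by
        rw [e2, ENNReal.ofReal_rpow_of_pos (by positivity), ← ENNReal.ofReal_mul (by positivity),
          ← ENNReal.ofReal_mul hQ0, ← ENNReal.ofReal_mul (by positivity)]
        congr 1; ring

/-- Averages over dyadic balls stay bounded by the average over the first ball. -/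
theorem dyadic_average_le (hd : d ≠ 0) (hf : AEMeasurable f volume) (hρ : ∀ x, 0 < ρ x)
    (hβ : 0 < β) (hθ : 0 ≤ θ) (hQ0 : 0 ≤ Q)
    (hQ : ∀ x r, 0 < r → campanatoMean β f x r ≤ ENNReal.ofReal Q * growth ρ θ x r)
    (x : EuclideanSpace ℝ (Fin d)) (hr : 0 < r) (n : ℕ) :
    ⨍ z in ball x (r / 2 ^ n), f z ∂volume ≤ ⨍ z in ball x r, f z ∂volume +
      2 ^ d * (Q * (1 + r / ρ x) ^ θ * (unitVolume d * r ^ d) ^ (β / d)) *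
        ∑ k ∈ Finset.range n, ((2 : ℝ) ^ (-β)) ^ k := by
  have hv := unitVolume_pos d
  have hρx := hρ x
  have hdR : (d : ℝ) ≠ 0 := by exact_mod_cast hd
  induction n with
  | zero => simp
  | succ n ih =>
    have hs : 0 < r / 2 ^ n := by positivity
    obtain ⟨m, -, hm, hosc, hint⟩ := exists_essInf_eq_coe (x₀ := x) hf hs
      (ne_top_of_le_ne_top ENNReal.ofReal_ne_top (lintegral_lowerOsc_le hd hρ hQ0 hQ x hs))
    have hR := lintegral_lowerOsc_le hd hρ hQ0 hQ x hs
    simp_rw [hosc] at hR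
    have e : r / 2 ^ n = 2 * (r / 2 ^ (n + 1)) := by rw [pow_succ]; field_simp
    have h1 : ⨍ z in ball x (r / 2 ^ (n + 1)), f z ∂volume ≤ m + 2 ^ d *
        (Q * (1 + r / 2 ^ n / ρ x) ^ θ * (unitVolume d * (r / 2 ^ n) ^ d) ^ (β / d)) := by
      apply average_sub_le (x := x) hd (by positivity)
      · apply ball_subset_ball
        have : 0 < r / 2 ^ (n + 1) := by positivity
        linarith
      · rwa [← e]
      · rwa [← e]
      · rwa [← e]
      · positivity
    -- The essential infimum `m` on the larger ball links consecutive averages: it is at most the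
    -- larger average, and the smaller average exceeds it by at most `2^d` times the normalised
    -- oscillation.
    have h2 := le_average hs hm hint
    have h3 : (unitVolume d * (r / 2 ^ n) ^ d) ^ (β / d) =
        (unitVolume d * r ^ d) ^ (β / d) * ((2 : ℝ) ^ (-β)) ^ n := by
      have e3 : unitVolume d * (r / 2 ^ n) ^ d = unitVolume d * r ^ d * ((2 ^ n) ^ d)⁻¹ := by
        rw [div_pow]; ring
      rw [e3, Real.mul_rpow (by positivity) (by positivity)]
      congr 1
      rw [← pow_mul, ← Real.rpow_natCast 2, ← Real.rpow_neg (by norm_num),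
        ← Real.rpow_mul (by norm_num), ← Real.rpow_natCast, ← Real.rpow_mul (by norm_num)]
      congr 1
      push_cast
      field_simp
    have h4 : (1 + r / 2 ^ n / ρ x) ^ θ ≤ (1 + r / ρ x) ^ θ := by
      gcongr
      exact div_le_self hr.le (one_le_pow₀ one_le_two)
    calc _ ≤ m + 2 ^ d *
        (Q * (1 + r / 2 ^ n / ρ x) ^ θ * (unitVolume d * (r / 2 ^ n) ^ d) ^ (β / d)) := h1
      _ ≤ ⨍ z in ball x (r / 2 ^ n), f z ∂volume + 2 ^ d *
        (Q * (1 + r / ρ x) ^ θ * ((unitVolume d * r ^ d) ^ (β / d) * ((2 : ℝ) ^ (-β)) ^ n)) := by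
          rw [h3]; gcongr
      _ ≤ _ := by
          rw [Finset.sum_range_succ]
          linarith

/-- Moving the centre from `x₀` to `x` multiplies `r/ρ(x₀)` by `ρ(x₀)/ρ(x) ≤ C₀ (1 + r/ρ(x₀))^N₀`;
this is the source of the exponent `N₀ + 1`. -/
theorem one_add_div_le_of_slowlyVarying {C₀ N₀ : ℝ} (hC₀ : 1 ≤ C₀) (hN₀ : 0 < N₀)
    (hρ : ∀ x, 0 < ρ x) (h : SlowlyVarying ρ C₀ N₀) (hr : 0 < r) {x : EuclideanSpace ℝ (Fin d)}
    (hx : dist x₀ x ≤ r) : 1 + r / ρ x ≤ 2 * C₀ * (1 + r / ρ x₀) ^ (N₀ + 1) := by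
  have h0 := hρ x₀
  have h1 := hρ x
  have hC : 0 < C₀ := by linarith
  set t := r / ρ x₀ with ht
  have ht0 : 0 < t := by positivity
  have hlow : 1 / C₀ * (1 + t) ^ (-N₀) ≤ ρ x / ρ x₀ := by
    refine le_trans ?_ (h x₀ x).1
    gcongr 1 / C₀ * ?_
    apply Real.rpow_le_rpow_of_nonpos (by positivity) ?_ (by linarith)
    rw [ht]
    gcongr
  rw [Real.rpow_neg (by positivity), one_div, ← mul_inv] at hlow
  have h2 : ρ x₀ / ρ x ≤ C₀ * (1 + t) ^ N₀ := by
    rw [← inv_div]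
    exact inv_le_of_inv_le₀ (by positivity) hlow
  have h3 : r / ρ x = t * (ρ x₀ / ρ x) := by rw [ht]; field_simp
  have h4 : 1 ≤ (1 + t) ^ (N₀ + 1) := Real.one_le_rpow (by linarith) (by linarith)
  calc 1 + r / ρ x ≤ C₀ * (1 + t) ^ (N₀ + 1) + (1 + t) * (C₀ * (1 + t) ^ N₀) := by
        rw [h3]
        gcongr
        · exact one_le_mul_of_one_le_of_one_le hC₀ h4
        · linarith
    _ = _ := by rw [Real.rpow_add_one (by positivity)]; ring

theorem tendsto_div_two_pow_nhdsGT {r : ℝ} (hr : 0 < r) :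
    Filter.Tendsto (fun n : ℕ => r / 2 ^ n) Filter.atTop (nhdsWithin 0 (Set.Ioi 0)) := by
  refine tendsto_nhdsWithin_iff.2 ⟨?_, Filter.Eventually.of_forall fun n => ?_⟩
  · have := (tendsto_pow_atTop_nhds_zero_of_lt_one (r := (1 / 2 : ℝ)) (by norm_num)
      (by norm_num)).const_mul r
    simpa [div_eq_mul_inv] using this
  · exact div_pos hr (by positivity)

set_option maxHeartbeats 800000 in
/-- Functions in the Campanato-type class are bounded on balls by their essential infimum plus a
power of the radius. -/
theorem ae_lowerOsc_le {C₀ N₀ : ℝ} (hd : d ≠ 0) (hC₀ : 1 ≤ C₀) (hN₀ : 0 < N₀)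
    (hρ : ∀ x, 0 < ρ x) (hslow : SlowlyVarying ρ C₀ N₀) (hβ : 0 < β) (hθ : 0 < θ) (hQ0 : 0 ≤ Q)
    (hf : LocallyIntegrable f volume)
    (hQ : ∀ x r, 0 < r → campanatoMean β f x r ≤ ENNReal.ofReal Q * growth ρ θ x r)
    (x₀ : EuclideanSpace ℝ (Fin d)) (hr : 0 < r) :
    ∀ᵐ x ∂volume.restrict (ball x₀ r), lowerOsc f (ball x₀ r) x ≤
      volume (ball x₀ r) ^ (β / d) * (ENNReal.ofReal
        (2 ^ d * (2 ^ β * 2 ^ θ + (2 * C₀) ^ θ * (1 - 2 ^ (-β))⁻¹)) *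
        growth ρ ((N₀ + 1) * θ) x₀ r * ENNReal.ofReal Q) := by
  have hv := unitVolume_pos d
  have hρ0 := hρ x₀
  have hC : 0 < C₀ := by linarith
  have hdR : (d : ℝ) ≠ 0 := by exact_mod_cast hd
  have hfm : AEMeasurable f volume := hf.aestronglyMeasurable.aemeasurable
  have h2r : 0 < 2 * r := by positivity
  obtain ⟨m, hmeq, hm, hosc, hint⟩ := exists_essInf_eq_coe (x₀ := x₀) hfm h2r
    (ne_top_of_le_ne_top ENNReal.ofReal_ne_top (lintegral_lowerOsc_le hd hρ hQ0 hQ x₀ h2r))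
  obtain ⟨m', hmeq', -, hosc', -⟩ := exists_essInf_eq_coe (x₀ := x₀) hfm hr
    (ne_top_of_le_ne_top ENNReal.ofReal_ne_top (lintegral_lowerOsc_le hd hρ hQ0 hQ x₀ hr))
  -- Balls `B(x, r)` centred in `B(x₀, r)` only fit into `B(x₀, 2r)`, so the argument runs with the
  -- infimum `m` there; being smaller than `m'`, it may replace it at the end.
  have hmm : m ≤ m' := by
    have : essInf (fun y => (f y : EReal)) (volume.restrict (ball x₀ (2 * r))) ≤
        essInf (fun y => (f y : EReal)) (volume.restrict (ball x₀ r)) :=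
      essInf_antitone_measure (Measure.restrict_mono (ball_subset_ball (by linarith)) le_rfl
        |>.absolutelyContinuous)
    rw [hmeq, hmeq'] at this
    exact_mod_cast this
  have hR := lintegral_lowerOsc_le hd hρ hQ0 hQ x₀ h2r
  simp_rw [hosc] at hR
  set W := (unitVolume d * r ^ d) ^ (β / d) with hW
  have hW0 : 0 < W := by positivity
  set P := (1 + r / ρ x₀) ^ ((N₀ + 1) * θ) with hP
  have hq1 : (2 : ℝ) ^ (-β) < 1 := Real.rpow_lt_one_of_one_lt_of_neg one_lt_two (by linarith)
  have hq0 : (0 : ℝ) < 2 ^ (-β) := by positivity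
  have hgeo : ∀ n : ℕ, ∑ k ∈ Finset.range n, ((2 : ℝ) ^ (-β)) ^ k ≤ (1 - 2 ^ (-β))⁻¹ := by
    intro n
    rw [← tsum_geometric_of_lt_one hq0.le hq1]
    exact (summable_geometric_of_lt_one hq0.le hq1).sum_le_tsum _ (fun _ _ => by positivity)
  have hinv : 0 < (1 - (2 : ℝ) ^ (-β))⁻¹ := inv_pos.2 (by linarith)
  have hbase : 1 ≤ 1 + r / ρ x₀ := by
    have : 0 < r / ρ x₀ := by positivity
    linarith
  have hW2 : (unitVolume d * (2 * r) ^ d) ^ (β / d) = 2 ^ β * W := by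
    rw [mul_pow, mul_left_comm, Real.mul_rpow (by positivity) (by positivity),
      ← Real.rpow_natCast 2, ← Real.rpow_mul (by norm_num), mul_div_cancel₀ _ hdR]
  have hG2 : (1 + 2 * r / ρ x₀) ^ θ ≤ 2 ^ θ * P := by
    calc (1 + 2 * r / ρ x₀) ^ θ ≤ (2 * (1 + r / ρ x₀)) ^ θ := by
          gcongr
          rw [mul_div_assoc]; linarith
      _ = 2 ^ θ * (1 + r / ρ x₀) ^ θ := Real.mul_rpow (by norm_num) (by positivity)
      _ ≤ _ := by
          gcongr 2 ^ θ * ?_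
          exact Real.rpow_le_rpow_of_exponent_le hbase (by nlinarith)
  have hG1 : ∀ x ∈ ball x₀ r, (1 + r / ρ x) ^ θ ≤ (2 * C₀) ^ θ * P := by
    intro x hx
    have hρx := hρ x
    have := one_add_div_le_of_slowlyVarying hC₀ hN₀ hρ hslow hr (x := x)
      (by rw [dist_comm]; exact (mem_ball.1 hx).le)
    calc (1 + r / ρ x) ^ θ ≤ (2 * C₀ * (1 + r / ρ x₀) ^ (N₀ + 1)) ^ θ := by gcongr
      _ = _ := by
        rw [Real.mul_rpow (by positivity) (by positivity), ← Real.rpow_mul (by positivity)]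
  have hfirst : ∀ x ∈ ball x₀ r,
      ⨍ z in ball x r, f z ∂volume ≤ m + 2 ^ d * (Q * (2 ^ θ * P) * (2 ^ β * W)) := by
    intro x hx
    refine (average_sub_le (x := x₀) hd hr (ball_subset_ball' ?_) hm hint hR
      (by positivity)).trans ?_
    · rw [mem_ball] at hx; linarith
    · rw [hW2]; gcongr
  filter_upwards [ae_restrict_of_ae (ae_tendsto_average_ball hd hf),
    ae_restrict_mem measurableSet_ball] with x hlim hx
  have hρx := hρ x
  have hδ : Filter.Tendsto (fun n : ℕ => r / 2 ^ n) Filter.atTop (nhdsWithin 0 (Set.Ioi 0)) :=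
    tendsto_div_two_pow_nhdsGT hr
  -- The first error compares `B(x, r)` with `B(x₀, 2r)`; the second sums the dyadic steps at `x`,
  -- where `(2 C₀)^θ` accounts for the change of centre in `ρ`.
  have hbound : f x ≤ m + 2 ^ d * (Q * (2 ^ θ * P) * (2 ^ β * W)) +
      2 ^ d * (Q * ((2 * C₀) ^ θ * P) * W) * (1 - 2 ^ (-β))⁻¹ := by
    refine le_of_tendsto (hlim _ hδ) (Filter.Eventually.of_forall fun n => ?_)
    refine (dyadic_average_le hd hfm hρ hβ hθ.le hQ0 hQ x hr n).trans ?_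
    gcongr
    · exact hfirst x hx
    · exact hG1 x hx
    · exact hgeo n
  rw [hosc', volume_ball_eq hd x₀ hr.le, ENNReal.ofReal_rpow_of_pos (by positivity), growth,
    ← ENNReal.ofReal_mul (by positivity), ← ENNReal.ofReal_mul (by positivity),
    ← ENNReal.ofReal_mul (by positivity)]
  apply ENNReal.ofReal_le_ofReal
  rw [← hW, ← hP]
  calc f x - m' ≤ f x - m := by linarith
    _ ≤ 2 ^ d * (Q * (2 ^ θ * P) * (2 ^ β * W)) +
      2 ^ d * (Q * ((2 * C₀) ^ θ * P) * W) * (1 - 2 ^ (-β))⁻¹ := by linarith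
    _ = _ := by ring

end Pointwise

end SchrodingerCampanato

/-! ### The main theorem. -/

theorem mainTheorem7 (d : ℕ) (hd : 3 ≤ d) (s : ℝ≥0∞) (hs : (d : ℝ≥0∞) / 2 ≤ s)
    (V : EuclideanSpace ℝ (Fin d) → ℝ) (hV : SchrodingerCampanato.ReverseHolder s V)
    (hV0 : ¬ V =ᵐ[volume] 0) :
    -- admissible constants `C₀`, `N₀` exist
    (∃ C₀ N₀ : ℝ, 1 ≤ C₀ ∧ 0 < N₀ ∧
      SchrodingerCampanato.SlowlyVarying (SchrodingerCampanato.criticalRadius V) C₀ N₀) ∧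
    -- the forward estimate, for all admissible `C₀`, `N₀`
    (∀ C₀ N₀ : ℝ, 1 ≤ C₀ → 0 < N₀ →
      SchrodingerCampanato.SlowlyVarying (SchrodingerCampanato.criticalRadius V) C₀ N₀ →
      ∀ β θ₁ : ℝ, 0 < β → β < 1 → 0 < θ₁ →
      ∃ C : ℝ, 0 < C ∧
        ∀ p q θ₂ : ℝ, 1 ≤ p → p < q → 0 < θ₂ →
        ∀ ω : EuclideanSpace ℝ (Fin d) → ℝ,
          SchrodingerCampanato.MemApq (SchrodingerCampanato.criticalRadius V) p q θ₂ ω →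
        ∀ f : EuclideanSpace ℝ (Fin d) → ℝ,
          SchrodingerCampanato.MemCampanato (SchrodingerCampanato.criticalRadius V) β θ₁ f →
        ∀ (x₀ : EuclideanSpace ℝ (Fin d)) (r : ℝ), 0 < r →
          SchrodingerCampanato.weightedMean p q β ω f x₀ r ≤
            ENNReal.ofReal C *
              SchrodingerCampanato.apqConst (SchrodingerCampanato.criticalRadius V) p q θ₂ ω *
              SchrodingerCampanato.growth (SchrodingerCampanato.criticalRadius V)
                ((N₀ + 1) * θ₁ + θ₂) x₀ r *
              SchrodingerCampanato.campanatoConst (SchrodingerCampanato.criticalRadius V) β θ₁ f) ∧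
    -- the converse
    (∀ p q β θ₁ θ₂ : ℝ, 1 ≤ p → p < q → 0 < β → β < 1 → 0 < θ₁ → 0 < θ₂ →
      ∀ ω : EuclideanSpace ℝ (Fin d) → ℝ,
        SchrodingerCampanato.MemApq (SchrodingerCampanato.criticalRadius V) p q θ₂ ω →
      ∀ f : EuclideanSpace ℝ (Fin d) → ℝ, AEMeasurable f volume →
      ∀ C : ℝ, 0 < C →
        (∀ (x₀ : EuclideanSpace ℝ (Fin d)) (r : ℝ), 0 < r →
          SchrodingerCampanato.weightedMean p q β ω f x₀ r ≤
            ENNReal.ofReal C *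
              SchrodingerCampanato.apqConst (SchrodingerCampanato.criticalRadius V) p q θ₂ ω *
              SchrodingerCampanato.growth (SchrodingerCampanato.criticalRadius V)
                (θ₁ - θ₂) x₀ r) →
        SchrodingerCampanato.MemCampanato (SchrodingerCampanato.criticalRadius V) β θ₁ f ∧
        SchrodingerCampanato.campanatoConst (SchrodingerCampanato.criticalRadius V) β θ₁ f ≤
          ENNReal.ofReal C *
            SchrodingerCampanato.apqConst (SchrodingerCampanato.criticalRadius V) p q θ₂ ω ^ 2) := by
  have hd0 : d ≠ 0 := by omega
  obtain ⟨hρ, hex⟩ := hV.criticalRadius_pos_and_exists hd hs hV0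
  refine ⟨hex, ?_, ?_⟩
  · intro C₀ N₀ hC₀ hN₀ hslow β θ₁ hβ _ hθ₁
    have hq1 : (2 : ℝ) ^ (-β) < 1 := Real.rpow_lt_one_of_one_lt_of_neg one_lt_two (by linarith)
    have hinv : 0 < (1 - (2 : ℝ) ^ (-β))⁻¹ := inv_pos.2 (by linarith)
    refine ⟨2 ^ d * (2 ^ β * 2 ^ θ₁ + (2 * C₀) ^ θ₁ * (1 - 2 ^ (-β))⁻¹), by positivity, ?_⟩
    intro p q θ₂ hp hpq _ ω hω f hf x₀ r hr
    have hQt : SchrodingerCampanato.campanatoConst (SchrodingerCampanato.criticalRadius V) β θ₁ f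
        ≠ ∞ := SchrodingerCampanato.iSup_growth_ne_top hρ hf.2
    have hosc := SchrodingerCampanato.ae_lowerOsc_le hd0 hC₀ hN₀ hρ hslow hβ hθ₁
      ENNReal.toReal_nonneg hf.1 (fun x r hr => by
        rw [ENNReal.ofReal_toReal hQt]
        exact SchrodingerCampanato.le_iSup_growth hρ
          (SchrodingerCampanato.campanatoMean β f) x hr) x₀ hr
    rw [ENNReal.ofReal_toReal hQt] at hosc
    have hA := SchrodingerCampanato.le_iSup_growth hρ (θ := θ₂)
      (fun x r => SchrodingerCampanato.meanPow q ω (ball x r) *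
        SchrodingerCampanato.dualMean p ω (ball x r)) x₀ hr
    refine (hω.weightedMean_le hp hpq β hr hosc).trans ((mul_le_mul_right hA _).trans ?_)
    rw [← SchrodingerCampanato.growth_mul (hρ x₀) hr, SchrodingerCampanato.apqConst]
    exact le_of_eq (by ring)
  · intro p q β θ₁ θ₂ hp hpq _ _ _ _ ω hω f hf C hC h
    have hAt : SchrodingerCampanato.apqConst (SchrodingerCampanato.criticalRadius V) p q θ₂ ω
        ≠ ∞ := SchrodingerCampanato.iSup_growth_ne_top hρ hω.2
    have hmean : ∀ x₀ r, 0 < r → SchrodingerCampanato.campanatoMean β f x₀ r ≤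
        ENNReal.ofReal C *
          SchrodingerCampanato.apqConst (SchrodingerCampanato.criticalRadius V) p q θ₂ ω ^ 2 *
          SchrodingerCampanato.growth (SchrodingerCampanato.criticalRadius V) θ₁ x₀ r := by
      intro x₀ r hr
      have hA := SchrodingerCampanato.le_iSup_growth hρ (θ := θ₂)
        (fun x r => SchrodingerCampanato.meanPow q ω (ball x r) *
          SchrodingerCampanato.dualMean p ω (ball x r)) x₀ hr
      refine (hω.campanatoMean_le hp hpq β hf hr).trans
        ((mul_le_mul' hA (h x₀ r hr)).trans (le_of_eq ?_))
      have hg : SchrodingerCampanato.growth (SchrodingerCampanato.criticalRadius V) θ₁ x₀ r =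
          SchrodingerCampanato.growth (SchrodingerCampanato.criticalRadius V) θ₂ x₀ r *
          SchrodingerCampanato.growth (SchrodingerCampanato.criticalRadius V) (θ₁ - θ₂) x₀ r := by
        rw [SchrodingerCampanato.growth_mul (hρ x₀) hr, add_sub_cancel]
      rw [hg, SchrodingerCampanato.apqConst]
      ring
    have hKt : ENNReal.ofReal C *
        SchrodingerCampanato.apqConst (SchrodingerCampanato.criticalRadius V) p q θ₂ ω ^ 2 ≠ ∞ :=
      ENNReal.mul_ne_top ENNReal.ofReal_ne_top (ENNReal.pow_ne_top hAt)
    set K := (ENNReal.ofReal C *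
        SchrodingerCampanato.apqConst (SchrodingerCampanato.criticalRadius V) p q θ₂ ω ^ 2) with hK
    have hmean' : ∀ x₀ r, 0 < r → SchrodingerCampanato.campanatoMean β f x₀ r ≤
        ENNReal.ofReal K.toReal *
          SchrodingerCampanato.growth (SchrodingerCampanato.criticalRadius V) θ₁ x₀ r := by
      rwa [ENNReal.ofReal_toReal hKt]
    -- Finite mean oscillation on unit balls already forces local integrability of `f`. The added
    -- `1` makes the membership constant positive.
    refine ⟨⟨fun x => ⟨ball x 1, ball_mem_nhds x one_pos, ?_⟩,
      K.toReal + 1, by positivity, fun x₀ r hr => ?_⟩, ?_⟩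
    · have hfin := ne_top_of_le_ne_top ENNReal.ofReal_ne_top
        (SchrodingerCampanato.lintegral_lowerOsc_le hd0 hρ ENNReal.toReal_nonneg hmean' x one_pos)
      obtain ⟨-, -, -, -, hint⟩ := SchrodingerCampanato.exists_essInf_eq_coe hf one_pos hfin
      exact hint
    · refine (hmean' x₀ r hr).trans ?_
      gcongr
      linarith
    · exact iSup_le fun x₀ => iSup_le fun r => iSup_le fun hr =>
        (SchrodingerCampanato.growth_neg_mul_le_iff (hρ x₀) hr).2 (hmean x₀ r hr)
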